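/- For $n\in\mathbb N$ let $d_{\rm H}(\sigma,\tau)=\frac1n|\{j:\sigma(j)\neq\tau(j)\}|$ be the normalized Hamming metric on the symmetric group $S_n$ and on its subgroup $A_n$. Let $\omega$ be a non-principal ultrafilter on $\mathbb N$. For a sequence $(m_i)$ of natural numbers, the metric ultraproduct $\prod_{i\to\omega}(A_{m_i},d_{\rm H})$ is the quotient of $\prod_i A_{m_i}$ by the normal subgroup $\{(g_i):\lim_{i\to\omega}d_{\rm H}(g_i,1)=0\}$; if $\lim_{i\to\omega}m_i=\infty$, it is called a metric ultraproduct of alternating groups of unbounded degree. The Hamming length of the class $x$ of $(x_i)$ is $\ell_{\rm H}(x)=\lim_{i\to\omega}d_{\rm H}(x_i,1)\in[0,1]$. **Theorem.** Let $G=\prod_{i\to\omega}(A_{n_i},d_{\rm H})$ with $\lim_{i\to\omega}n_i=\infty$, let $x\in G$ be an element of prime order $p$, and let $C=C_G(x)$ be its centralizer. Then $$C\;\cong\;(M\rtimes T_1)\times T_2 ,$$ where - $T_1$ is a metric ultraproduct (with respect to $\omega$) of alternating groups of unbounded degree; - $M$ is an infinite $\mathbb F_pT_1$-module having a submodule $N$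 of order $p$ such that $M/N$ is a simple $\mathbb F_pT_1$-module, and the semidirect product is formed with respect to the module action of $T_1$ on $M$; - $T_2$ is a metric ultraproduct (with respect to $\omega$) of alternating groups of unbounded degree if $\ell_{\rm H}(x)<1$, and $T_2$ is finite if $\ell_{\rm H}(x)=1$. -/

import Mathlib

open Filter Topology

/-- A normalized bi-invariant metric `d : G × G → [0,1]` on a group `G`. -/
structure NormalizedBiinvMetric (G : Type*) [Group G] where
  d : G → G → ℝ
  d_nonneg : ∀ g h, 0 ≤ d g h
  d_le_one : ∀ g h, d g h ≤ 1
  d_eq_zero_iff : ∀ g h, d g h = 0 ↔ g = h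
  d_comm : ∀ g h, d g h = d h g
  d_triangle : ∀ g h k, d g k ≤ d g h + d h k
  d_mul_left : ∀ g h k, d (g * h) (g * k) = d h k
  d_mul_right : ∀ g h k, d (h * g) (k * g) = d h k

namespace NormalizedBiinvMetric

/-- The restriction of a normalized bi-invariant metric to a subgroup. -/
def restrict {G : Type*} [Group G] (D : NormalizedBiinvMetric G) (H : Subgroup G) :
    NormalizedBiinvMetric H where
  d g h := D.d g h
  d_nonneg _ _ := D.d_nonneg _ _
  d_le_one _ _ := D.d_le_one _ _
  d_eq_zero_iff _ _ := (D.d_eq_zero_iff _ _).trans Subtype.ext_iff.symm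
  d_comm _ _ := D.d_comm _ _
  d_triangle _ _ _ := D.d_triangle _ _ _
  d_mul_left _ _ _ := D.d_mul_left _ _ _
  d_mul_right _ _ _ := D.d_mul_right _ _ _

theorem d_mul_mul_le {G : Type*} [Group G] (D : NormalizedBiinvMetric G) (a b : G) :
    D.d (a * b) 1 ≤ D.d a 1 + D.d b 1 := by
  have h := D.d_triangle (a * b) b 1
  have h2 := D.d_mul_right b a 1
  rw [one_mul] at h2
  linarith

theorem d_inv_one {G : Type*} [Group G] (D : NormalizedBiinvMetric G) (a : G) :
    D.d a⁻¹ 1 = D.d a 1 := by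
  have h := D.d_mul_left a a⁻¹ 1
  rw [mul_inv_cancel, mul_one] at h
  rw [← h, D.d_comm]

theorem d_conj_one {G : Type*} [Group G] (D : NormalizedBiinvMetric G) (a g : G) :
    D.d (g * a * g⁻¹) 1 = D.d a 1 := by
  have h := D.d_mul_right g⁻¹ (g * a) g
  have h2 := D.d_mul_left g a 1
  rw [mul_inv_cancel] at h
  rw [mul_one] at h2
  rw [h, h2]

theorem d_eq_d_inv_mul {G : Type*} [Group G] (D : NormalizedBiinvMetric G) (a b : G) :
    D.d a b = D.d (a⁻¹ * b) 1 := by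
  have h := D.d_mul_left a⁻¹ a b
  rw [inv_mul_cancel] at h
  rw [← h, D.d_comm]

end NormalizedBiinvMetric

section MetricUltraproduct

/-- The sequences `(g_i)` with `lim_{i → ω} d_i(g_i, 1) = 0`. -/
def metricNullSubgroup (ω : Ultrafilter ℕ) {G : ℕ → Type*} [∀ i, Group (G i)]
    (D : ∀ i, NormalizedBiinvMetric (G i)) : Subgroup (∀ i, G i) where
  carrier := {g | Tendsto (fun i => (D i).d (g i) 1) (ω : Filter ℕ) (𝓝 0)}
  one_mem' := by
    have h : ∀ i, (D i).d ((1 : ∀ i, G i) i) 1 = 0 := fun i => ((D i).d_eq_zero_iff _ _).2 rfl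
    simp only [Set.mem_ofPred_eq, h]
    exact tendsto_const_nhds
  mul_mem' := by
    intro a b ha hb
    have hab := Tendsto.add ha hb
    rw [add_zero] at hab
    exact squeeze_zero (fun i => (D i).d_nonneg _ _) (fun i => (D i).d_mul_mul_le _ _) hab
  inv_mem' := by
    intro a ha
    have h : ∀ i, (D i).d (a⁻¹ i) 1 = (D i).d (a i) 1 := fun i => (D i).d_inv_one (a i)
    simp only [Set.mem_ofPred_eq, h]
    exact ha

instance metricNullSubgroup_normal (ω : Ultrafilter ℕ) {G : ℕ → Type*} [∀ i, Group (G i)]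
    (D : ∀ i, NormalizedBiinvMetric (G i)) : (metricNullSubgroup ω D).Normal where
  conj_mem := by
    intro a ha g
    have h : ∀ i, (D i).d ((g * a * g⁻¹) i) 1 = (D i).d (a i) 1 :=
      fun i => (D i).d_conj_one (a i) (g i)
    change Tendsto _ _ _
    simp only [h]
    exact ha

/-- The metric ultraproduct `∏_{i → ω} (G_i, d_i)`. -/
abbrev MetricUltraproduct (ω : Ultrafilter ℕ) {G : ℕ → Type*} [∀ i, Group (G i)]
    (D : ∀ i, NormalizedBiinvMetric (G i)) : Type _ :=
  (∀ i, G i) ⧸ metricNullSubgroup ω D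

/-- The pseudometric `lim_{i → ω} d_i(g_i, h_i)` on the Cartesian product. -/
noncomputable def ultraDist (ω : Ultrafilter ℕ) {G : ℕ → Type*} [∀ i, Group (G i)]
    (D : ∀ i, NormalizedBiinvMetric (G i)) (g h : ∀ i, G i) : ℝ :=
  limUnder (ω : Filter ℕ) (fun i => (D i).d (g i) (h i))

theorem tendsto_ultraDist (ω : Ultrafilter ℕ) {G : ℕ → Type*} [∀ i, Group (G i)]
    (D : ∀ i, NormalizedBiinvMetric (G i)) (g h : ∀ i, G i) :
    Tendsto (fun i => (D i).d (g i) (h i)) (ω : Filter ℕ) (𝓝 (ultraDist ω D g h)) := by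
  apply tendsto_nhds_limUnder
  have hc : IsCompact (Set.Icc (0 : ℝ) 1) := isCompact_Icc
  obtain ⟨a, -, ha⟩ := hc.ultrafilter_le_nhds (ω.map fun i : ℕ => (D i).d (g i) (h i))
    (by
      rw [le_principal_iff]
      exact Filter.univ_mem' (f := (ω : Filter ℕ)) fun i => ⟨(D i).d_nonneg _ _, (D i).d_le_one _ _⟩)
  exact ⟨a, ha⟩

theorem ultraDist_le_of_rel (ω : Ultrafilter ℕ) {G : ℕ → Type*} [∀ i, Group (G i)]
    (D : ∀ i, NormalizedBiinvMetric (G i)) (a b a' b' : ∀ i, G i)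
    (ha : a⁻¹ * a' ∈ metricNullSubgroup ω D) (hb : b⁻¹ * b' ∈ metricNullSubgroup ω D) :
    ultraDist ω D a b ≤ ultraDist ω D a' b' := by
  have h := ((show Tendsto _ _ _ from ha).add (tendsto_ultraDist ω D a' b')).add
    (show Tendsto _ _ _ from hb)
  rw [zero_add, add_zero] at h
  refine le_of_tendsto_of_tendsto' (tendsto_ultraDist ω D a b) h fun i => ?_
  have h1 := (D i).d_triangle (a i) (a' i) (b i)
  have h2 := (D i).d_triangle (a' i) (b' i) (b i)
  have h3 := (D i).d_eq_d_inv_mul (a i) (a' i)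
  have h4 := (D i).d_eq_d_inv_mul (b i) (b' i)
  have h5 := (D i).d_comm (b i) (b' i)
  simp only [Pi.mul_apply, Pi.inv_apply]
  linarith

/-- The metric on the metric ultraproduct induced by `lim_{i → ω} d_i(g_i, h_i)`. -/
noncomputable def MetricUltraproduct.dist (ω : Ultrafilter ℕ) {G : ℕ → Type*} [∀ i, Group (G i)]
    (D : ∀ i, NormalizedBiinvMetric (G i)) (x y : MetricUltraproduct ω D) : ℝ :=
  Quotient.liftOn₂' x y (ultraDist ω D) (by
    intro a b a' b' ha hb
    rw [QuotientGroup.leftRel_apply] at ha hb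
    refine le_antisymm (ultraDist_le_of_rel ω D a b a' b' ha hb)
      (ultraDist_le_of_rel ω D a' b' a b ?_ ?_)
    · simpa using inv_mem ha
    · simpa using inv_mem hb)

end MetricUltraproduct

section Alternating

/-- The Hamming distance `d_H(σ, τ) = (1/n) |{j | σ(j) ≠ τ(j)}|` on the symmetric group `S_n`. -/
noncomputable def hammingMetric (n : ℕ) : NormalizedBiinvMetric (Equiv.Perm (Fin n)) where
  d σ τ := (1 / (n : ℝ)) * ((Finset.univ.filter fun j => σ j ≠ τ j).card : ℝ)
  d_nonneg _ _ := by positivity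
  d_le_one σ τ := by
    have h : (Finset.univ.filter fun j => σ j ≠ τ j).card ≤ n := by
      simpa using Finset.card_le_univ (Finset.univ.filter fun j => σ j ≠ τ j)
    rw [one_div, inv_mul_eq_div]
    exact div_le_one_of_le₀ (by exact_mod_cast h) (by positivity)
  d_eq_zero_iff σ τ := by
    rcases Nat.eq_zero_or_pos n with rfl | hn
    · simp [Subsingleton.elim σ τ]
    · have hn' : (n : ℝ) ≠ 0 := by positivity
      simp [hn', Finset.filter_eq_empty_iff, Equiv.ext_iff]
  d_comm σ τ := by simp only [ne_comm]
  d_triangle σ τ ρ := by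
    rw [← mul_add]
    refine mul_le_mul_of_nonneg_left ?_ (by positivity)
    exact_mod_cast hammingDist_triangle (σ : Fin n → Fin n) τ ρ
  d_mul_left σ τ ρ := by simp
  d_mul_right σ τ ρ := by
    congr 2
    refine Finset.card_bij (fun j _ => σ j) ?_ ?_ ?_
    · intro j hj
      exact Finset.mem_filter.2 ⟨Finset.mem_univ _, (Finset.mem_filter.1 hj).2⟩
    · intro a _ b _ hab
      exact σ.injective hab
    · intro b hb
      exact ⟨σ.symm b, Finset.mem_filter.2 ⟨Finset.mem_univ _, by
        simpa using (Finset.mem_filter.1 hb).2⟩, by simp⟩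

/-- The Hamming metric on the alternating group `A_n`. -/
noncomputable def altMetric (n : ℕ) : NormalizedBiinvMetric (alternatingGroup (Fin n)) :=
  (hammingMetric n).restrict _

/-- The metric ultraproduct `∏_{i → ω} (A_{n_i}, d_H)` of alternating groups. -/
abbrev AltUltraproduct (ω : Ultrafilter ℕ) (n : ℕ → ℕ) : Type :=
  MetricUltraproduct ω fun i => altMetric (n i)

/-- The Hamming length `ℓ_H(x) = d(x, 1) = lim_{i → ω} d_H(x_i, 1)` on `∏_{i → ω} (A_{n_i}, d_H)`. -/
noncomputable def hammingLength (ω : Ultrafilter ℕ) (n : ℕ → ℕ) (x : AltUltraproduct ω n) : ℝ :=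
  MetricUltraproduct.dist ω (fun i => altMetric (n i)) x 1

end Alternating

/-- The action of a group `T` by automorphisms on a `kT`-module `M`, where `M` is written
multiplicatively: `t` acts as the element `1 · t` of the group algebra. -/
noncomputable def moduleAut (k T M : Type*) [CommRing k] [Group T] [AddCommGroup M]
    [Module (MonoidAlgebra k T) M] : T →* MulAut (Multiplicative M) :=
  (MulAutMultiplicative M).symm.toMonoidHom.comp
    ((DistribMulAction.toAddAut (MonoidAlgebra k T)ˣ M).comp (MonoidAlgebra.of k T).toHomUnits)

theorem moduleAut_apply (k T M : Type*) [CommRing k] [Group T] [AddCommGroup M]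
    [Module (MonoidAlgebra k T) M] (t : T) (m : M) :
    moduleAut k T M t (Multiplicative.ofAdd m) =
      Multiplicative.ofAdd ((MonoidAlgebra.single t 1 : MonoidAlgebra k T) • m) := rfl

/-! Lift `x` to permutations `σ i`. Along `ω` the power `σ i ^ p` moves only a negligible proportion
of points, so restricting `σ i` to the fixed points of that power gives a nearby `y i` with `y i ^ p
= 1`: it has `m i` cycles of length `p` and `k i` fixed points. As `x ≠ 1`, `m i` is at least a
fixed positive fraction of `n i`, so negligibility can be measured against either. Correcting parity
costs two points, so symmetric groups may replace alternating ones.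

Commuting with `y i` is stable (`exists_near_of_almost_commute`): a permutation that nearly commutes
with it carries most cycles rigidly onto cycles, hence is close to one that commutes exactly. The
centralizer of `x` is therefore the image of the finite centralizers, each a wreath product of `ZMod
p` with the symmetric group on `m i` cycles, times the symmetric group on `k i` points. Modulo
negligible changes the base of the wreath product becomes `M`, the `ZMod p`-valued functions on
cycles; its top becomes `T₁`, and the last factor `T₂`. The latter is trivial exactly when `k` is
negligible, that is, when the Hamming length is 1.

`N` consists of the constants. For simplicity of `M / N` (`eq_top_of_mem_of_not_const`), a function
that is not almost constant takes two values on non-negligible sets. Subtracting permuted copies of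
it isolates differences of indicators `1_A - 1_B`; adding `p` of these with the same `B` kills `B`
and leaves the indicator of a set. Boundedly many such indicators span any given function up to a
negligible error. -/

/-- A sequence of counts `c` is negligible at scale `N` along `ω` if `c / N → 0` along `ω`. -/
def Negligible (ω : Ultrafilter ℕ) (N c : ℕ → ℕ) : Prop :=
  ∀ K : ℕ, ∀ᶠ i in (ω : Filter ℕ), K * c i ≤ N i

/-! ### Calculus of negligible counts along an ultrafilter -/

namespace Negligible

variable {ω : Ultrafilter ℕ} {N N' c c' : ℕ → ℕ}

theorem mono (h : Negligible ω N c) (hc : ∀ᶠ i in (ω : Filter ℕ), c' i ≤ c i) :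
    Negligible ω N c' := fun K => by
  filter_upwards [h K, hc] with i h1 h2
  exact (Nat.mul_le_mul_left K h2).trans h1

theorem mono' (h : Negligible ω N c) (hc : ∀ i, c' i ≤ c i) : Negligible ω N c' :=
  h.mono (Eventually.of_forall hc)

theorem zero : Negligible ω N fun _ => 0 := fun K => by simp

theorem add (h : Negligible ω N c) (h' : Negligible ω N c') :
    Negligible ω N fun i => c i + c' i := fun K => by
  filter_upwards [h (2 * K), h' (2 * K)] with i h1 h2
  nlinarith

theorem const_mul (C : ℕ) (h : Negligible ω N c) : Negligible ω N fun i => C * c i := fun K => by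
  filter_upwards [h (K * C)] with i h1
  rwa [← mul_assoc]

theorem sum {ι : Type*} (s : Finset ι) {c : ι → ℕ → ℕ} (h : ∀ a ∈ s, Negligible ω N (c a)) :
    Negligible ω N fun i => ∑ a ∈ s, c a i := by
  classical
  induction s using Finset.induction_on with
  | empty => simpa using zero
  | insert a s ha ih =>
    simp only [Finset.sum_insert ha]
    exact (h a (by simp)).add (ih fun b hb => h b (by simp [hb]))

theorem const (hN : Tendsto N (ω : Filter ℕ) atTop) (C : ℕ) : Negligible ω N fun _ => C :=
  fun K => hN.eventually_ge_atTop (K * C)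

theorem of_scale_le (C : ℕ) (hN : ∀ᶠ i in (ω : Filter ℕ), N i ≤ C * N' i)
    (h : Negligible ω N c) : Negligible ω N' c := fun K => by
  filter_upwards [h ((C + 1) * K), hN] with i h1 h2
  -- `C + 1` in place of `C` keeps the cancelled factor positive.
  have h3 : (C + 1) * (K * c i) ≤ (C + 1) * N' i := by nlinarith
  exact Nat.le_of_mul_le_mul_left h3 (Nat.succ_pos C)

/-- Here the ultrafilter property enters: failing to hold eventually means that the negation holds
eventually, so one `K` serves on a set in `ω`. -/
theorem exists_of_not (h : ¬ Negligible ω N c) :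
    ∃ K : ℕ, ∀ᶠ i in (ω : Filter ℕ), N i < K * c i := by
  simp only [Negligible, not_forall] at h
  obtain ⟨K, hK⟩ := h
  refine ⟨K, ?_⟩
  simpa using Ultrafilter.eventually_not.2 hK

theorem tendsto_iff (hc : ∀ i, c i ≤ N i) :
    Tendsto (fun i => (1 / (N i : ℝ)) * (c i : ℝ)) (ω : Filter ℕ) (𝓝 0) ↔ Negligible ω N c := by
  constructor
  · intro h K
    have hpos : (0 : ℝ) < 1 / ((K : ℝ) + 1) := by positivity
    filter_upwards [h.eventually_lt_const hpos] with i hi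
    -- For `N i = 0` the real quotient is 0 by convention and says nothing; the bound `c i ≤ N i`
    -- covers this case.
    rcases Nat.eq_zero_or_pos (N i) with h0 | h0
    · have := hc i
      simp_all
    · have h0' : (0 : ℝ) < N i := by exact_mod_cast h0
      rw [one_div, inv_mul_eq_div, div_lt_div_iff₀ h0' (by positivity)] at hi
      have h2 : (c i : ℝ) * (K + 1) < N i := by linarith
      have h3 : c i * (K + 1) < N i := by exact_mod_cast h2
      nlinarith
  · intro h
    rw [tendsto_order]
    refine ⟨fun a ha => Eventually.of_forall fun i => ha.trans_le (by positivity), fun a ha => ?_⟩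
    obtain ⟨K, hK⟩ := exists_nat_gt (1 / a)
    filter_upwards [h K] with i hi
    rcases Nat.eq_zero_or_pos (N i) with h0 | h0
    · simpa [h0] using ha
    · have h0' : (0 : ℝ) < N i := by exact_mod_cast h0
      rw [one_div, inv_mul_eq_div, div_lt_iff₀ h0']
      have hi' : (K : ℝ) * c i ≤ N i := by exact_mod_cast hi
      rcases Nat.eq_zero_or_pos (c i) with h1 | h1
      · simpa [h1] using mul_pos ha h0'
      · have h1' : (0 : ℝ) < c i := by exact_mod_cast h1
        have h4 : 1 < a * K := by
          rw [div_lt_iff₀ ha] at hK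
          linarith
        nlinarith

end Negligible

/-! ### Permutations modulo negligible changes; alternating versus symmetric groups -/

section AsymptoticPerm

/-- Sequences of permutations moving a negligible number of points. -/
def permNull (ω : Ultrafilter ℕ) (N : ℕ → ℕ) (X : ℕ → Type*) [∀ i, Fintype (X i)]
    [∀ i, DecidableEq (X i)] : Subgroup (∀ i, Equiv.Perm (X i)) where
  carrier := {σ | Negligible ω N fun i => (σ i).support.card}
  one_mem' := by simpa using Negligible.zero
  mul_mem' := by
    intro a b ha hb
    refine (Negligible.add ha hb).mono' fun i => ?_
    exact (Finset.card_le_card (Equiv.Perm.support_mul_le (a i) (b i))).trans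
      (Finset.card_union_le _ _)
  inv_mem' := by
    intro a ha
    simpa using ha

variable {ω : Ultrafilter ℕ} {N : ℕ → ℕ} {X : ℕ → Type*} [∀ i, Fintype (X i)]
    [∀ i, DecidableEq (X i)]

theorem mem_permNull {σ : ∀ i, Equiv.Perm (X i)} :
    σ ∈ permNull ω N X ↔ Negligible ω N fun i => (σ i).support.card := Iff.rfl

instance permNull_normal : (permNull ω N X).Normal where
  conj_mem := by
    intro a ha g
    simpa [mem_permNull] using ha

/-- Sequences of permutations of the `X i`, up to changes on a number of points which is
negligible at scale `N`. -/
abbrev AsymptoticPerm (ω : Ultrafilter ℕ) (N : ℕ → ℕ) (X : ℕ → Type*) [∀ i, Fintype (X i)]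
    [∀ i, DecidableEq (X i)] : Type _ :=
  (∀ i, Equiv.Perm (X i)) ⧸ permNull ω N X

theorem inv_mul_mem_permNull {σ τ : ∀ i, Equiv.Perm (X i)} :
    σ⁻¹ * τ ∈ permNull ω N X ↔
      Negligible ω N fun i => (Finset.univ.filter fun j => σ i j ≠ τ i j).card := by
  rw [mem_permNull]
  have : ∀ i, ((σ⁻¹ * τ) i).support = Finset.univ.filter fun j => σ i j ≠ τ i j := by
    intro i
    ext j
    rw [Equiv.Perm.mem_support, Finset.mem_filter, Pi.mul_apply, Pi.inv_apply,
      Equiv.Perm.mul_apply, ne_eq, Equiv.Perm.inv_eq_iff_eq, eq_comm]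
    simp
  simp only [this]

theorem AsymptoticPerm.mk_eq_iff {σ τ : ∀ i, Equiv.Perm (X i)} :
    (σ : AsymptoticPerm ω N X) = τ ↔
      Negligible ω N fun i => (Finset.univ.filter fun j => σ i j ≠ τ i j).card := by
  rw [QuotientGroup.eq, inv_mul_mem_permNull]

theorem mem_altNull {s : ℕ → ℕ} {g : ∀ i, alternatingGroup (Fin (s i))} :
    g ∈ metricNullSubgroup ω (fun i => altMetric (s i)) ↔
      Negligible ω s fun i => (g i : Equiv.Perm (Fin (s i))).support.card := by
  rw [← Negligible.tendsto_iff]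
  · rfl
  · intro i
    simpa using Finset.card_le_univ (g i : Equiv.Perm (Fin (s i))).support

/-- The coordinatewise inclusion of alternating groups in symmetric groups. -/
def altInclusion (s : ℕ → ℕ) :
    (∀ i, alternatingGroup (Fin (s i))) →* ∀ i, Equiv.Perm (Fin (s i)) where
  toFun g i := g i
  map_one' := rfl
  map_mul' _ _ := rfl

/-- An odd permutation moves some point `a`; multiplying by the transposition of `σ a` and `a`
repairs the sign and affects only these two points. -/
theorem exists_alternating_near {n : ℕ} (σ : Equiv.Perm (Fin n)) :
    ∃ g : alternatingGroup (Fin n),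
      (Finset.univ.filter fun j => (g : Equiv.Perm (Fin n)) j ≠ σ j).card ≤ 2 := by
  by_cases h : Equiv.Perm.sign σ = 1
  · exact ⟨⟨σ, h⟩, by simp⟩
  · have h1 : Equiv.Perm.sign σ = -1 := (Int.units_eq_one_or _).resolve_left h
    have hne : σ ≠ 1 := by
      rintro rfl
      simp at h
    obtain ⟨a, ha⟩ : ∃ a, σ a ≠ a := by
      by_contra! hh
      exact hne (Equiv.ext hh)
    refine ⟨⟨σ * Equiv.swap (σ a) a, ?_⟩, ?_⟩
    · rw [Equiv.Perm.mem_alternatingGroup, Equiv.Perm.sign_mul, Equiv.Perm.sign_swap ha, h1]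
      simp
    · refine le_trans (Finset.card_le_card (t := {σ a, a}) ?_) Finset.card_le_two
      intro j hj
      by_contra hc
      simp only [Finset.mem_insert, Finset.mem_singleton, not_or] at hc
      simp [Equiv.swap_apply_of_ne_of_ne hc.1 hc.2] at hj

/-- Metric ultraproducts of alternating and of symmetric groups agree. -/
noncomputable def altEquivAsymptoticPerm {s : ℕ → ℕ} (hN : Tendsto N (ω : Filter ℕ) atTop)
    (hs : ∀ c : ℕ → ℕ, (∀ i, c i ≤ s i) → (Negligible ω s c ↔ Negligible ω N c)) :
    AltUltraproduct ω s ≃* AsymptoticPerm ω N fun i => Fin (s i) := by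
  have key : ∀ g : ∀ i, alternatingGroup (Fin (s i)),
      g ∈ metricNullSubgroup ω (fun i => altMetric (s i)) ↔
        altInclusion s g ∈ permNull ω N fun i => Fin (s i) := by
    intro g
    rw [mem_altNull, hs]
    · rfl
    · intro i
      simpa using Finset.card_le_univ (g i : Equiv.Perm (Fin (s i))).support
  have le : metricNullSubgroup ω (fun i => altMetric (s i)) ≤
      (permNull ω N fun i => Fin (s i)).comap (altInclusion s) := fun g hg => (key g).1 hg
  refine MulEquiv.ofBijective
    (QuotientGroup.map _ (permNull ω N fun i => Fin (s i)) (altInclusion s) le) ⟨?_, ?_⟩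
  · rw [injective_iff_map_eq_one]
    intro a
    induction a using QuotientGroup.induction_on with
    | H g =>
      intro h
      rw [QuotientGroup.map_mk, QuotientGroup.eq_one_iff (altInclusion s g)] at h
      rw [QuotientGroup.eq_one_iff]
      exact (key g).2 h
  · intro b
    induction b using QuotientGroup.induction_on with
    | H σ =>
      choose g hg using fun i => exists_alternating_near (σ i)
      refine ⟨(g : AltUltraproduct ω s), ?_⟩
      rw [QuotientGroup.map_mk, AsymptoticPerm.mk_eq_iff]
      exact (Negligible.const hN 2).mono' hg

theorem card_support_permCongr {α β : Type*} [Fintype α] [DecidableEq α] [Fintype β]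
    [DecidableEq β] (e : α ≃ β) (σ : Equiv.Perm α) :
    (e.permCongr σ).support.card = σ.support.card := by
  refine (Finset.card_bij (fun j _ => e j) ?_ ?_ ?_).symm
  · intro j hj
    simpa using hj
  · intro a _ b _ hab
    exact e.injective hab
  · intro b hb
    refine ⟨e.symm b, ?_, by simp⟩
    rw [Equiv.Perm.mem_support] at hb ⊢
    intro h
    apply hb
    rw [Equiv.permCongr_apply, h, Equiv.apply_symm_apply]

/-- Relabelling the points. -/
def AsymptoticPerm.congr {Y : ℕ → Type*} [∀ i, Fintype (Y i)] [∀ i, DecidableEq (Y i)]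
    (e : ∀ i, X i ≃ Y i) : AsymptoticPerm ω N X ≃* AsymptoticPerm ω N Y :=
  QuotientGroup.congr _ _ (MulEquiv.piCongrRight fun i => (e i).permCongrHom) (by
    ext σ
    change σ ∈ Subgroup.map (MulEquiv.toMonoidHom _) _ ↔ _
    rw [Subgroup.mem_map_equiv, mem_permNull, mem_permNull]
    have : ∀ i, (((MulEquiv.piCongrRight fun i => (e i).permCongrHom).symm σ) i).support.card =
        (σ i).support.card := fun i => card_support_permCongr (e i).symm (σ i)
    simp only [this])

end AsymptoticPerm

/-! ### Extending and exchanging sets by finite permutations -/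

section FinitePermutations

variable {α : Type*} [Fintype α] [DecidableEq α]

theorem exists_perm_extending (s : Finset α) (g : α → α) (hg : Set.InjOn g s) :
    ∃ σ : Equiv.Perm α, ∀ j ∈ s, σ j = g j := by
  obtain ⟨e, he⟩ := Finset.exists_equiv_extend_of_card_eq (t := Finset.univ) (by simp)
    (Finset.subset_univ _) hg
  exact ⟨e.trans (Equiv.subtypeUnivEquiv (by simp)), he⟩

omit [Fintype α] in
theorem exists_injOn_of_card_le {A B : Finset α} (h : A.card ≤ B.card) :
    ∃ g : α → α, Set.InjOn g A ∧ (∀ j ∈ A, g j ∈ B) ∧ ∀ j ∉ A, g j = j := by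
  obtain ⟨C, hCB, hC⟩ := Finset.exists_subset_card_eq h
  have e := Finset.equivOfCardEq hC.symm
  refine ⟨fun j => if hj : j ∈ A then e ⟨j, hj⟩ else j, ?_, ?_, ?_⟩
  · intro i hi j hj hij
    simp only [Finset.mem_coe] at hi hj
    simpa [hi, hj] using hij
  · intro j hj
    simpa [hj] using hCB (e ⟨j, hj⟩).2
  · intro j hj
    simp [hj]

/-- A permutation exchanging two disjoint sets of the same cardinality. -/
theorem exists_perm_exchange {A B : Finset α} (hAB : Disjoint A B) (h : A.card = B.card) :
    ∃ τ : Equiv.Perm α, (∀ j ∈ A, τ j ∈ B) ∧ (∀ j ∈ B, τ j ∈ A) ∧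
      ∀ j, j ∉ A → j ∉ B → τ j = j := by
  obtain ⟨g, hg, hgm, hgo⟩ := exists_injOn_of_card_le h.le
  have hsurj : ∀ j ∈ B, ∃ i ∈ A, g i = j := by
    have := Finset.surjOn_of_injOn_of_card_le g hgm hg h.ge
    intro j hj
    obtain ⟨i, hi, rfl⟩ := this hj
    exact ⟨i, hi, rfl⟩
  -- Prescribing `τ` off `B` is enough: the images of the complement of `B` fill the complement of
  -- `A`, so `B` must go to `A`.
  obtain ⟨τ, hτ⟩ := exists_perm_extending Bᶜ g (by
    intro i hi j hj hij
    simp only [Finset.coe_compl, Set.mem_compl_iff, Finset.mem_coe] at hi hj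
    by_cases hiA : i ∈ A <;> by_cases hjA : j ∈ A
    · exact hg hiA hjA hij
    · rw [hgo j hjA] at hij
      exact absurd (hij ▸ hgm i hiA) hj
    · rw [hgo i hiA] at hij
      exact absurd (hij ▸ hgm j hjA) hi
    · rwa [hgo i hiA, hgo j hjA] at hij)
  have hτA : ∀ j ∈ A, τ j = g j := fun j hj =>
    hτ j (Finset.mem_compl.2 (Finset.disjoint_left.1 hAB hj))
  have hτo : ∀ j, j ∉ A → j ∉ B → τ j = j := fun j hjA hjB => by
    rw [hτ j (Finset.mem_compl.2 hjB), hgo j hjA]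
  refine ⟨τ, fun j hj => hτA j hj ▸ hgm j hj, fun j hj => ?_, hτo⟩
  by_contra hA
  by_cases hB : τ j ∈ B
  · obtain ⟨i, hi, hij⟩ := hsurj _ hB
    rw [← hτA i hi] at hij
    exact Finset.disjoint_left.1 hAB (τ.injective hij ▸ hi) hj
  · have := τ.injective (hτo _ hA hB)
    exact hB (this.symm ▸ hj)

/-- Let `π` carry `A` into the fibre over `a` and `B` into the fibre over `b`. Precomposing with an
exchange of `A` and `B` swaps the two values there and changes nothing elsewhere, so all other
values of `f` cancel. -/
theorem exists_perm_sub_perm {k : Type*} [CommRing k] [DecidableEq k] (f : α → k) (a b : k)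
    {A B : Finset α}
    (hAB : Disjoint A B) (h : A.card = B.card)
    (ha : A.card ≤ (Finset.univ.filter fun j => f j = a).card)
    (hb : B.card ≤ (Finset.univ.filter fun j => f j = b).card) (hab : a ≠ b) :
    ∃ π π' : Equiv.Perm α, ∀ j, f (π j) - f (π' j) =
      (a - b) * ((if j ∈ A then 1 else 0) - (if j ∈ B then 1 else 0)) := by
  obtain ⟨gA, hgA, hgAm, -⟩ := exists_injOn_of_card_le ha
  obtain ⟨gB, hgB, hgBm, -⟩ := exists_injOn_of_card_le hb
  simp only [Finset.mem_filter, Finset.mem_univ, true_and] at hgAm hgBm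
  obtain ⟨τ, hτA, hτB, hτo⟩ := exists_perm_exchange hAB h
  obtain ⟨π, hπ⟩ := exists_perm_extending (A ∪ B) (fun j => if j ∈ A then gA j else gB j) (by
    intro i hi j hj hij
    simp only [Finset.coe_union, Set.mem_union, Finset.mem_coe] at hi hj
    by_cases hiA : i ∈ A <;> by_cases hjA : j ∈ A <;> simp only [hiA, hjA, if_true, if_false] at hij
    · exact hgA hiA hjA hij
    · have h1 := hgAm i hiA
      rw [hij, hgBm j (hj.resolve_left hjA)] at h1
      exact absurd h1.symm hab
    · have h1 := hgAm j hjA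
      rw [← hij, hgBm i (hi.resolve_left hiA)] at h1
      exact absurd h1.symm hab
    · exact hgB (hi.resolve_left hiA) (hj.resolve_left hjA) hij)
  have hA : ∀ j ∈ A, f (π j) = a := fun j hj => by
    rw [hπ j (Finset.mem_union_left _ hj)]
    simpa [hj] using hgAm j hj
  have hB : ∀ j ∈ B, f (π j) = b := fun j hj => by
    rw [hπ j (Finset.mem_union_right _ hj)]
    simpa [Finset.disjoint_right.1 hAB hj] using hgBm j hj
  refine ⟨π, π * τ, fun j => ?_⟩
  rw [Equiv.Perm.mul_apply]
  by_cases hjA : j ∈ A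
  · simp [hjA, Finset.disjoint_left.1 hAB hjA, hA j hjA, hB _ (hτA j hjA)]
  · by_cases hjB : j ∈ B
    · simp [hjA, hjB, hB j hjB, hA _ (hτB j hjB)]
    · simp [hjA, hjB, hτo j hjA hjB]

omit [Fintype α] in
theorem exists_partition_card_eq {p t : ℕ} {S : Finset α} (hS : S.card = p * t) :
    ∃ P : Fin p → Finset α, (∀ j, (P j).card = t) ∧ (∀ j, P j ⊆ S) ∧
      ∀ r ∈ S, ∃ j, ∀ j', r ∈ P j' ↔ j' = j := by
  have e : S ≃ Fin p × Fin t :=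
    (Finset.equivFinOfCardEq hS).trans finProdFinEquiv.symm
  refine ⟨fun j => Finset.univ.image fun l => (e.symm (j, l) : α), fun j => ?_, fun j r hr => ?_,
    fun r hr => ⟨(e ⟨r, hr⟩).1, fun j' => ?_⟩⟩
  · rw [Finset.card_image_of_injective _ fun l l' hl => by simpa using Subtype.ext hl]
    simp
  · obtain ⟨l, -, rfl⟩ := Finset.mem_image.1 hr
    exact (e.symm (j, l)).2
  · simp only [Finset.mem_image, Finset.mem_univ, true_and]
    constructor
    · rintro ⟨l, rfl⟩
      simp
    · rintro rfl
      exact ⟨(e ⟨r, hr⟩).2, by simp⟩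

end FinitePermutations

/-! ### Functions modulo negligible support, and what one function generates -/

section AsymptoticFun

variable (ω : Ultrafilter ℕ) (m : ℕ → ℕ) (p : ℕ)

/-- Sequences of functions with negligible support. -/
def funNull : Submodule (ZMod p) (∀ i, Fin (m i) → ZMod p) where
  carrier := {f | Negligible ω m fun i => (Finset.univ.filter fun r => f i r ≠ 0).card}
  zero_mem' := by simpa using Negligible.zero
  add_mem' := by
    intro f g hf hg
    refine (Negligible.add hf hg).mono' fun i => ?_
    refine le_trans (Finset.card_le_card fun r hr => ?_) (Finset.card_union_le _ _)
    simp only [Finset.mem_union, Finset.mem_filter, Finset.mem_univ, true_and] at hr ⊢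
    by_contra! h
    exact hr (by simp [h.1, h.2])
  smul_mem' := by
    intro c f hf
    refine Negligible.mono' hf fun i => Finset.card_le_card fun r hr => ?_
    simp only [Finset.mem_filter, Finset.mem_univ, true_and] at hr ⊢
    intro h
    exact hr (by simp [h])

variable {ω m p}

theorem mem_funNull {f : ∀ i, Fin (m i) → ZMod p} : f ∈ funNull ω m p ↔
    Negligible ω m fun i => (Finset.univ.filter fun r => f i r ≠ 0).card := Iff.rfl

variable (m p) in
/-- Permutations act on functions by permuting the coordinates. -/
def permuteFun : (∀ i, Equiv.Perm (Fin (m i))) →*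
    Module.End (ZMod p) (∀ i, Fin (m i) → ZMod p) where
  toFun σ :=
    { toFun := fun f i r => f i ((σ i).symm r)
      map_add' := fun _ _ => rfl
      map_smul' := fun _ _ => rfl }
  map_one' := rfl
  map_mul' _ _ := rfl

@[simp]
theorem permuteFun_apply (σ : ∀ i, Equiv.Perm (Fin (m i))) (f : ∀ i, Fin (m i) → ZMod p) (i : ℕ)
    (r : Fin (m i)) : permuteFun m p σ f i r = f i ((σ i).symm r) := rfl

theorem permuteFun_mem_funNull (σ : ∀ i, Equiv.Perm (Fin (m i))) {f : ∀ i, Fin (m i) → ZMod p}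
    (hf : f ∈ funNull ω m p) : permuteFun m p σ f ∈ funNull ω m p := by
  rw [mem_funNull] at hf ⊢
  refine hf.mono' fun i => ?_
  refine Finset.card_le_card_of_injOn (σ i).symm (fun r hr => ?_) (σ i).symm.injective.injOn
  exact Finset.mem_coe.2 (Finset.mem_filter.2
    ⟨Finset.mem_univ _, (Finset.mem_filter.1 (Finset.mem_coe.1 hr)).2⟩)

theorem permuteFun_sub_mem_funNull {σ : ∀ i, Equiv.Perm (Fin (m i))}
    (hσ : σ ∈ permNull ω m fun i => Fin (m i)) (f : ∀ i, Fin (m i) → ZMod p) :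
    permuteFun m p σ f - f ∈ funNull ω m p := by
  rw [mem_funNull]
  refine Negligible.mono' hσ fun i => Finset.card_le_card fun r hr => ?_
  rw [← Equiv.Perm.support_inv, Equiv.Perm.mem_support]
  intro h
  have h' : (σ i).symm r = r := h
  exact (Finset.mem_filter.1 hr).2 (by simp [h'])

variable (ω m p) in
/-- Sequences of `ZMod p`-valued functions up to negligible changes. -/
abbrev AsymptoticFun : Type := (∀ i, Fin (m i) → ZMod p) ⧸ funNull ω m p

variable (ω m p) in
/-- The action of `AsymptoticPerm` on `AsymptoticFun`. -/
def asymptoticRep : Representation (ZMod p) (AsymptoticPerm ω m fun i => Fin (m i))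
    (AsymptoticFun ω m p) :=
  QuotientGroup.lift _
    ({ toFun := fun σ => Submodule.mapQ _ _ (permuteFun m p σ)
        fun _ hf => permuteFun_mem_funNull σ hf
       map_one' := by
        ext x
        rfl
       map_mul' := fun σ τ => by
        ext x
        rfl } :
      (∀ i, Equiv.Perm (Fin (m i))) →* Module.End (ZMod p) (AsymptoticFun ω m p)) (by
    intro σ hσ
    refine LinearMap.ext fun x => ?_
    induction x using Submodule.Quotient.induction_on with
    | H f => exact (Submodule.Quotient.eq _).2 (permuteFun_sub_mem_funNull hσ f))

variable (p) in
/-- Indicator functions. -/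
def indicatorFun (S : ∀ i, Finset (Fin (m i))) : ∀ i, Fin (m i) → ZMod p :=
  fun i r => if r ∈ S i then 1 else 0

variable (m p) in
/-- Constant functions. -/
def constFun : ZMod p →ₗ[ZMod p] ∀ i, Fin (m i) → ZMod p where
  toFun a _ _ := a
  map_add' _ _ := rfl
  map_smul' _ _ := rfl

@[simp]
theorem constFun_apply (a : ZMod p) (i : ℕ) (r : Fin (m i)) : constFun m p a i r = a := rfl

variable [Fact p.Prime]

/-- If every value other than `a` were taken negligibly often, `f` would agree with the constant `a`
off a finite union of negligible sets. So some value other than any given one is frequent; using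
this twice gives two. -/
theorem exists_two_values {f : ∀ i, Fin (m i) → ZMod p}
    (hf : ∀ a, f - constFun m p a ∉ funNull ω m p) :
    ∃ a b : ZMod p, a ≠ b ∧
      ¬ Negligible ω m (fun i => (Finset.univ.filter fun r => f i r = a).card) ∧
      ¬ Negligible ω m (fun i => (Finset.univ.filter fun r => f i r = b).card) := by
  have key : ∀ a : ZMod p, ∃ b, b ≠ a ∧
      ¬ Negligible ω m (fun i => (Finset.univ.filter fun r => f i r = b).card) := by
    intro a
    by_contra! h
    apply hf a
    have h1 := Negligible.sum (Finset.univ.filter fun b => b ≠ a) fun b hb =>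
      h b (Finset.mem_filter.1 hb).2
    refine h1.mono' fun i => ?_
    refine le_trans (Finset.card_le_card fun r hr => ?_) Finset.card_biUnion_le
    simp only [Finset.mem_filter, Finset.mem_univ, true_and, Pi.sub_apply, constFun_apply, ne_eq,
      sub_eq_zero, Finset.mem_biUnion] at hr ⊢
    exact ⟨_, hr, rfl⟩
  obtain ⟨a, -, ha⟩ := key 0
  obtain ⟨b, hb, hb'⟩ := key a
  exact ⟨a, b, hb.symm, ha, hb'⟩

section Generation

variable {W : Submodule (ZMod p) (∀ i, Fin (m i) → ZMod p)}
  (hnull : funNull ω m p ≤ W) (hperm : ∀ σ, ∀ f ∈ W, permuteFun m p σ f ∈ W)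
  {f : ∀ i, Fin (m i) → ZMod p} (hf : f ∈ W) {a b : ZMod p} (hab : a ≠ b)

include hperm hf hab in
theorem indicatorFun_sub_mem {A B : ∀ i, Finset (Fin (m i))} (hAB : ∀ i, Disjoint (A i) (B i))
    (h : ∀ i, (A i).card = (B i).card)
    (ha : ∀ i, (A i).card ≤ (Finset.univ.filter fun r => f i r = a).card)
    (hb : ∀ i, (A i).card ≤ (Finset.univ.filter fun r => f i r = b).card) :
    indicatorFun p A - indicatorFun p B ∈ W := by
  choose π π' hπ using fun i =>
    exists_perm_sub_perm (f i) a b (hAB i) (h i) (ha i) ((h i) ▸ hb i) hab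
  have h1 := W.sub_mem (hperm (fun i => (π i).symm) f hf) (hperm (fun i => (π' i).symm) f hf)
  have h2 := W.smul_mem (a - b)⁻¹ h1
  convert h2 using 1
  ext i r
  have h3 : a - b ≠ 0 := sub_ne_zero.2 hab
  have h4 := hπ i r
  simp only [Pi.sub_apply, Pi.smul_apply, permuteFun_apply, Equiv.symm_symm, smul_eq_mul, h4,
    indicatorFun]
  field_simp

-- Cut `S` into `p` parts of size `t` and compare each with one common set `A` of size `t` outside
-- `S`. In the sum of the differences `A` is counted `p` times and vanishes in characteristic `p`.
-- The bound `(p + 1) * t i ≤ m i` leaves room for `A`.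
include hperm hf hab in
theorem indicatorFun_mem_of_card_eq {S : ∀ i, Finset (Fin (m i))} {t : ℕ → ℕ}
    (hS : ∀ i, (S i).card = p * t i) (hm : ∀ i, (p + 1) * t i ≤ m i)
    (ha : ∀ i, t i ≤ (Finset.univ.filter fun r => f i r = a).card)
    (hb : ∀ i, t i ≤ (Finset.univ.filter fun r => f i r = b).card) :
    indicatorFun p S ∈ W := by
  choose P hPc hPS hP using fun i => exists_partition_card_eq (hS i)
  have hex : ∀ i, ∃ A ⊆ (S i)ᶜ, A.card = t i := fun i => Finset.exists_subset_card_eq (by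
    rw [Finset.card_compl, Fintype.card_fin, hS]
    have := hm i
    rw [add_mul, one_mul] at this
    omega)
  choose A hAS hAc using hex
  have h1 : ∑ j : Fin p, (indicatorFun p (fun i => P i j) - indicatorFun p A) ∈ W := by
    refine W.sum_mem fun j _ => indicatorFun_sub_mem hperm hf hab (fun i => ?_) (fun i => ?_)
      (fun i => ?_) (fun i => ?_)
    · rw [Finset.disjoint_left]
      intro r hr hr'
      exact Finset.mem_compl.1 (hAS i hr') (hPS i j hr)
    · rw [hPc, hAc]
    · rw [hPc]; exact ha i
    · rw [hPc]; exact hb i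
  convert h1 using 1
  ext i r
  rw [Finset.sum_sub_distrib, Finset.sum_const, Finset.card_univ, Fintype.card_fin]
  simp only [Pi.sub_apply, Finset.sum_apply, nsmul_eq_mul, CharP.cast_eq_zero,
    zero_mul, sub_zero, Pi.mul_apply, Pi.natCast_apply, indicatorFun]
  by_cases hr : r ∈ S i
  · obtain ⟨j, hj⟩ := hP i r hr
    simp [hj, hr]
  · have : ∀ j, r ∉ P i j := fun j h => hr (hPS i j h)
    simp [hr, this]

-- Rounding the size of `S` down to a multiple of `p` discards fewer than `p` points, which is
-- negligible.
include hnull hperm hf hab in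
theorem indicatorFun_mem_of_card_le (hm' : Tendsto m (ω : Filter ℕ) atTop)
    {S : ∀ i, Finset (Fin (m i))} (hm : ∀ i, (p + 1) * (S i).card ≤ m i)
    (ha : ∀ i, (S i).card ≤ (Finset.univ.filter fun r => f i r = a).card)
    (hb : ∀ i, (S i).card ≤ (Finset.univ.filter fun r => f i r = b).card) :
    indicatorFun p S ∈ W := by
  have hp : p.Prime := Fact.out
  have hle : ∀ i, (S i).card / p ≤ (S i).card := fun i => Nat.div_le_self _ _
  choose S' hS' hc using fun i => Finset.exists_subset_card_eq (Nat.mul_div_le (S i).card p)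
  have h1 : indicatorFun p S' ∈ W := indicatorFun_mem_of_card_eq hperm hf hab hc
    (fun i => (Nat.mul_le_mul_left _ (hle i)).trans (hm i)) (fun i => (hle i).trans (ha i))
    (fun i => (hle i).trans (hb i))
  have h2 : indicatorFun p S - indicatorFun p S' ∈ funNull ω m p := by
    rw [mem_funNull]
    refine (Negligible.const hm' p).mono' fun i => ?_
    have h3 : (S i \ S' i).card ≤ p := by
      rw [Finset.card_sdiff_of_subset (hS' i), hc]
      have := Nat.div_add_mod (S i).card p
      have := Nat.mod_lt (S i).card hp.pos
      omega
    refine le_trans (Finset.card_le_card fun r hr => ?_) h3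
    replace hr := (Finset.mem_filter.1 hr).2
    simp only [Pi.sub_apply, indicatorFun] at hr
    by_cases h4 : r ∈ S' i
    · simp [h4, hS' i h4] at hr
    · by_cases h5 : r ∈ S i
      · simp [h4, h5]
      · simp [h4, h5] at hr
  simpa using W.add_mem (hnull h2) h1

include hnull hperm hf in
theorem eq_top_of_mem_of_not_const (hm : Tendsto m (ω : Filter ℕ) atTop)
    (hfc : ∀ a, f - constFun m p a ∉ funNull ω m p) : W = ⊤ := by
  obtain ⟨a, b, hab, ha, hb⟩ := exists_two_values hfc
  obtain ⟨Ka, hKa⟩ := Negligible.exists_of_not ha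
  obtain ⟨Kb, hKb⟩ := Negligible.exists_of_not hb
  -- The largest size allowed by all three bounds of `indicatorFun_mem_of_card_le`; it is a positive
  -- fraction of `m i`.
  let u : ℕ → ℕ := fun i => min (m i / (p + 1))
    (min (Finset.univ.filter fun r => f i r = a).card (Finset.univ.filter fun r => f i r = b).card)
  obtain ⟨K, hK⟩ : ∃ K, ∀ᶠ i in (ω : Filter ℕ), m i ≤ K * u i := by
    refine ⟨2 * (p + 1) + Ka + Kb, ?_⟩
    filter_upwards [hKa, hKb, hm.eventually_ge_atTop (p + 1)] with i h1 h2 h3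
    have h4 : m i ≤ 2 * (p + 1) * (m i / (p + 1)) := by
      have h5 := Nat.div_add_mod (m i) (p + 1)
      have h6 := Nat.mod_lt (m i) (Nat.succ_pos p)
      have h7 : 1 ≤ m i / (p + 1) := (Nat.one_le_div_iff (Nat.succ_pos p)).2 h3
      nlinarith
    simp only [u]
    rcases min_choice (m i / (p + 1)) (min (Finset.univ.filter fun r => f i r = a).card
      (Finset.univ.filter fun r => f i r = b).card) with h | h
    · rw [h]; nlinarith
    · rw [h]
      rcases min_choice (Finset.univ.filter fun r => f i r = a).card
        (Finset.univ.filter fun r => f i r = b).card with h | h <;> rw [h] <;> nlinarith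
  rw [eq_top_iff]
  rintro h -
  -- Level sets of `h` cut into blocks of length `u i`; at most `K` blocks occur, along `ω`. The
  -- condition `0 < u i` is needed since division by zero returns 0 and would put everything in
  -- block 0.
  let S : ZMod p → ℕ → ∀ i, Finset (Fin (m i)) := fun c q i =>
    Finset.univ.filter fun r => h i r = c ∧ (r : ℕ) / u i = q ∧ 0 < u i
  have hSu : ∀ c q i, (S c q i).card ≤ u i := by
    intro c q i
    rw [← Finset.card_range (u i)]
    refine Finset.card_le_card_of_injOn (fun r => (r : ℕ) % u i) (fun r hr => ?_)
      fun r hr r' hr' hrr => ?_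
    · simp only [S, Finset.coe_filter, Set.mem_ofPred_eq] at hr
      simpa using Nat.mod_lt _ hr.2.2.2
    · simp only [S, Finset.coe_filter, Set.mem_ofPred_eq] at hr hr'
      apply Fin.ext
      rw [← Nat.div_add_mod (r : ℕ) (u i), ← Nat.div_add_mod (r' : ℕ) (u i), hr.2.2.1, hr'.2.2.1]
      simpa using hrr
  have hS : ∀ c q, indicatorFun p (S c q) ∈ W := by
    intro c q
    refine indicatorFun_mem_of_card_le hnull hperm hf hab hm (fun i => ?_) (fun i => ?_)
      (fun i => ?_)
    · exact (Nat.mul_le_mul_left _ ((hSu c q i).trans (min_le_left _ _))).trans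
        (Nat.mul_div_le _ _)
    · exact (hSu c q i).trans ((min_le_right _ _).trans (min_le_left _ _))
    · exact (hSu c q i).trans ((min_le_right _ _).trans (min_le_right _ _))
  have h1 : ∑ c, ∑ q ∈ Finset.range K, c • indicatorFun p (S c q) ∈ W :=
    W.sum_mem fun c _ => W.sum_mem fun q _ => W.smul_mem c (hS c q)
  have h2 : h - ∑ c, ∑ q ∈ Finset.range K, c • indicatorFun p (S c q) ∈ funNull ω m p := by
    refine Negligible.zero.mono ?_
    filter_upwards [hK] with i hi
    rw [Nat.le_zero, Finset.card_eq_zero, Finset.filter_eq_empty_iff]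
    intro r _
    have hr : (r : ℕ) < K * u i := r.2.trans_le hi
    have hu : 0 < u i := Nat.pos_of_mul_pos_left (Nat.zero_lt_of_lt hr)
    have hq : (r : ℕ) / u i < K := Nat.div_lt_of_lt_mul (by rwa [mul_comm])
    simp only [Pi.sub_apply, Finset.sum_apply, Pi.smul_apply, indicatorFun, S, Finset.mem_filter,
      Finset.mem_univ, true_and, hu, and_true, ne_eq, not_not, sub_eq_zero, smul_eq_mul]
    rw [Finset.sum_eq_single (h i r) (by
      intro c _ hc
      simp [Ne.symm hc]) (by simp)]
    rw [Finset.sum_eq_single ((r : ℕ) / u i) (by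
      intro q _ hq'
      simp [Ne.symm hq']) (fun h => absurd (Finset.mem_range.2 hq) h)]
    simp
  simpa using W.add_mem (hnull h2) h1

end Generation

end AsymptoticFun

/-! ### The module `M`, its constants, and simplicity of the quotient -/

section AsymptoticModule

variable {ω : Ultrafilter ℕ} {m : ℕ → ℕ} {p : ℕ}

theorem mk_constFun_injective [Fact p.Prime] (hm : Tendsto m (ω : Filter ℕ) atTop) :
    Function.Injective ((funNull ω m p).mkQ ∘ₗ constFun m p) := by
  rw [injective_iff_map_eq_zero]
  intro a ha
  rw [LinearMap.comp_apply, Submodule.mkQ_apply, Submodule.Quotient.mk_eq_zero, mem_funNull] at ha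
  by_contra h
  obtain ⟨i, h1, h2⟩ := ((ha 2).and (hm.eventually_ge_atTop 1)).exists
  simp [h] at h1
  omega

/-- Initial segments of relative length `1 / (k + 1)` have indicators that differ pairwise on a
positive proportion of points. -/
theorem infinite_asymptoticFun [Fact p.Prime] (hm : Tendsto m (ω : Filter ℕ) atTop) :
    Infinite (AsymptoticFun ω m p) := by
  let F : ℕ → AsymptoticFun ω m p := fun k => Submodule.Quotient.mk
    (indicatorFun p fun i => Finset.univ.filter fun r : Fin (m i) => (r : ℕ) < m i / (k + 1))
  have key : ∀ k l, k < l → F k ≠ F l := by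
    intro k l hkl h
    rw [Submodule.Quotient.eq, mem_funNull] at h
    -- The proportions differ by at least `1 / ((k + 1) * (l + 1))`; the factor 2 and the lower
    -- bound on `m i` absorb the rounding.
    obtain ⟨i, h1, h2⟩ := ((h (2 * ((k + 1) * (l + 1)))).and
      (hm.eventually_ge_atTop (2 * ((k + 1) * (l + 1)) + 1))).exists
    have h3 : m i / (k + 1) - m i / (l + 1) ≤ (Finset.univ.filter fun r : Fin (m i) =>
        (indicatorFun p (fun i => Finset.univ.filter fun r : Fin (m i) => (r : ℕ) < m i / (k + 1)) -
        indicatorFun p (fun i => Finset.univ.filter fun r : Fin (m i) => (r : ℕ) < m i / (l + 1)))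
        i r ≠ 0).card := by
      rw [← Nat.card_Ico, ← Finset.card_map Fin.valEmbedding]
      refine Finset.card_le_card fun r hr => ?_
      rw [Finset.mem_Ico] at hr
      have hr' : r < m i := hr.2.trans_le (Nat.div_le_self _ _)
      refine Finset.mem_map.2 ⟨⟨r, hr'⟩, Finset.mem_filter.2 ⟨Finset.mem_univ _, ?_⟩, rfl⟩
      simp [indicatorFun, hr.2, hr.1.not_gt]
    have h4 := (Nat.mul_le_mul_left _ h3).trans h1
    obtain ⟨d, hd⟩ : ∃ d, d = m i / (k + 1) - m i / (l + 1) := ⟨_, rfl⟩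
    rw [← hd] at h4
    have h5 : m i / (k + 1) ≤ d + m i / (l + 1) := by omega
    have h6 := Nat.div_add_mod (m i) (k + 1)
    have h7 : m i % (k + 1) < k + 1 := Nat.mod_lt _ (Nat.succ_pos k)
    have h8 := Nat.mul_div_le (m i) (l + 1)
    have h9 : m i < (k + 1) * (d + m i / (l + 1)) + (k + 1) := by
      have := Nat.mul_le_mul_left (k + 1) h5
      omega
    have h10 : (l + 1) * m i < (k + 1) * (l + 1) * d + (k + 1) * ((l + 1) * (m i / (l + 1))) +
        (k + 1) * (l + 1) := by nlinarith
    have h11 := Nat.mul_le_mul_left (k + 1) h8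
    have h12 : (k + 1 + 1) * m i ≤ (l + 1) * m i := Nat.mul_le_mul_right _ (by omega)
    nlinarith
  refine Infinite.of_injective F fun k l hkl => ?_
  rcases lt_trichotomy k l with h | h | h
  · exact absurd hkl (key k l h)
  · exact h
  · exact absurd hkl.symm (key l k h)

variable {T : Type} [Group T] (E : T →* AsymptoticPerm ω m fun i => Fin (m i))

variable (p) in
/-- The module over the group algebra of `T` given by `AsymptoticFun` and a homomorphism
`E : T →* AsymptoticPerm`. -/
abbrev AsymptoticModule : Type :=
  Representation.asModule (V := AsymptoticFun ω m p) ((asymptoticRep ω m p).comp E)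

theorem single_smul_mk (t : T) (σ : ∀ i, Equiv.Perm (Fin (m i))) (hσ : E t = σ)
    (f : ∀ i, Fin (m i) → ZMod p) :
    (MonoidAlgebra.single t 1 : MonoidAlgebra (ZMod p) T) •
      (show AsymptoticModule p E from Submodule.Quotient.mk f) =
    (show AsymptoticModule p E from Submodule.Quotient.mk (permuteFun m p σ f)) := by
  rw [Representation.single_smul, one_smul, MonoidHom.comp_apply, hσ]
  rfl

variable (p) in
/-- The submodule of constant functions. -/
noncomputable def constSubmodule : Submodule (MonoidAlgebra (ZMod p) T) (AsymptoticModule p E) :=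
  MonoidAlgebra.submoduleOfSMulMem
    (LinearMap.range ((funNull ω m p).mkQ ∘ₗ constFun m p) :
      Submodule (ZMod p) (AsymptoticModule p E)) (by
    rintro t _ ⟨a, rfl⟩
    obtain ⟨σ, hσ⟩ := QuotientGroup.mk_surjective (E t)
    exact ⟨a, (single_smul_mk E t σ hσ.symm (constFun m p a)).symm⟩)

theorem mem_constSubmodule {f : ∀ i, Fin (m i) → ZMod p} :
    (show AsymptoticModule p E from Submodule.Quotient.mk f) ∈ constSubmodule p E ↔
      ∃ a, f - constFun m p a ∈ funNull ω m p := by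
  constructor
  · rintro ⟨a, ha⟩
    exact ⟨a, (Submodule.Quotient.eq _).1 ha.symm⟩
  · rintro ⟨a, ha⟩
    exact ⟨a, ((Submodule.Quotient.eq _).2 ha).symm⟩

theorem card_constSubmodule [Fact p.Prime] (hm : Tendsto m (ω : Filter ℕ) atTop) :
    Nat.card (constSubmodule p E) = p := by
  have := Nat.card_congr (LinearEquiv.ofInjective _ (mk_constFun_injective (p := p) hm)).toEquiv
  rw [Nat.card_zmod] at this
  exact this.symm

theorem isSimpleModule_quotient_constSubmodule [Fact p.Prime]
    (hm : Tendsto m (ω : Filter ℕ) atTop) (hE : Function.Surjective E) :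
    IsSimpleModule (MonoidAlgebra (ZMod p) T)
      (AsymptoticModule p E ⧸ constSubmodule p E) := by
  rw [isSimpleModule_iff_isCoatom]
  constructor
  · intro h
    have h1 := card_constSubmodule (p := p) E hm
    rw [h, Nat.card_congr (Equiv.subtypeUnivEquiv fun x => Submodule.mem_top)] at h1
    have h2 : Infinite (AsymptoticModule p E) := infinite_asymptoticFun hm
    rw [Nat.card_eq_zero_of_infinite] at h1
    exact (Fact.out : p.Prime).ne_zero h1.symm
  · intro W hW
    obtain ⟨x, hxW, hxN⟩ := SetLike.exists_of_lt hW
    obtain ⟨f, rfl⟩ := Submodule.Quotient.mk_surjective (funNull ω m p) x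
    let L : (∀ i, Fin (m i) → ZMod p) →ₗ[ZMod p] AsymptoticModule p E := (funNull ω m p).mkQ
    -- Pulled back to sequences of functions, `W` is invariant under all permutations because `E` is
    -- surjective.
    have h1 : (W.restrictScalars (ZMod p)).comap L = ⊤ := by
      refine eq_top_of_mem_of_not_const (ω := ω) (f := f) ?_ ?_ hxW hm fun a ha =>
        hxN ((mem_constSubmodule E).2 ⟨a, ha⟩)
      · intro g hg
        have : L g = 0 := (Submodule.Quotient.mk_eq_zero _).2 hg
        rw [Submodule.mem_comap, this]
        exact zero_mem _
      · intro σ g hg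
        obtain ⟨t, ht⟩ := hE σ
        have := W.smul_mem (MonoidAlgebra.single t 1 : MonoidAlgebra (ZMod p) T)
          (show L g ∈ W from hg)
        rwa [show L g = Submodule.Quotient.mk g from rfl, single_smul_mk E t σ ht] at this
    rw [eq_top_iff]
    rintro y -
    obtain ⟨g, rfl⟩ := Submodule.Quotient.mk_surjective (funNull ω m p) y
    exact (h1 ▸ Submodule.mem_top : g ∈ (W.restrictScalars (ZMod p)).comap L)

end AsymptoticModule

/-! ### The centralizer of a product of `p`-cycles at finite level -/

section StandardCycles

variable {p m k : ℕ}

/-- Translations along the cycles. -/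
def cycleTranslate : Multiplicative (Fin m → ZMod p) →*
    Equiv.Perm ((ZMod p × Fin m) ⊕ Fin k) where
  toFun f :=
    { toFun := Sum.map (fun x => (x.1 + f.toAdd x.2, x.2)) id
      invFun := Sum.map (fun x => (x.1 - f.toAdd x.2, x.2)) id
      left_inv := by rintro (⟨a, r⟩ | r) <;> simp
      right_inv := by rintro (⟨a, r⟩ | r) <;> simp }
  map_one' := by
    ext (⟨a, r⟩ | r) <;> simp
  map_mul' f g := by
    refine Equiv.ext ?_
    rintro (⟨a, r⟩ | r)
    · simp [add_assoc, add_comm (f.toAdd r)]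
    · simp

/-- Permutations of the set of cycles. -/
def cyclePermute : Equiv.Perm (Fin m) →* Equiv.Perm ((ZMod p × Fin m) ⊕ Fin k) where
  toFun σ := Equiv.sumCongr (Equiv.prodCongr (Equiv.refl _) σ) (Equiv.refl _)
  map_one' := by
    refine Equiv.ext ?_
    rintro (⟨a, r⟩ | r) <;> simp
  map_mul' f g := by
    refine Equiv.ext ?_
    rintro (⟨a, r⟩ | r) <;> simp

/-- Permutations of the fixed points. -/
def fixedPermute : Equiv.Perm (Fin k) →* Equiv.Perm ((ZMod p × Fin m) ⊕ Fin k) where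
  toFun σ := Equiv.sumCongr (Equiv.refl _) σ
  map_one' := by
    refine Equiv.ext ?_
    rintro (⟨a, r⟩ | r) <;> simp
  map_mul' f g := by
    refine Equiv.ext ?_
    rintro (⟨a, r⟩ | r) <;> simp

@[simp]
theorem cycleTranslate_inl (f : Multiplicative (Fin m → ZMod p)) (a : ZMod p) (r : Fin m) :
    cycleTranslate (k := k) f (Sum.inl (a, r)) = Sum.inl (a + f.toAdd r, r) := rfl

@[simp]
theorem cycleTranslate_inr (f : Multiplicative (Fin m → ZMod p)) (r : Fin k) :
    cycleTranslate f (Sum.inr r) = Sum.inr r := rfl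

@[simp]
theorem cyclePermute_inl (σ : Equiv.Perm (Fin m)) (a : ZMod p) (r : Fin m) :
    cyclePermute (k := k) σ (Sum.inl (a, r)) = Sum.inl (a, σ r) := rfl

@[simp]
theorem cyclePermute_inr (σ : Equiv.Perm (Fin m)) (r : Fin k) :
    cyclePermute (p := p) σ (Sum.inr r) = Sum.inr r := rfl

@[simp]
theorem fixedPermute_inl (σ : Equiv.Perm (Fin k)) (a : ZMod p) (r : Fin m) :
    fixedPermute σ (Sum.inl (a, r)) = Sum.inl (a, r) := rfl

@[simp]
theorem fixedPermute_inr (σ : Equiv.Perm (Fin k)) (r : Fin k) :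
    fixedPermute (p := p) (m := m) σ (Sum.inr r) = Sum.inr (σ r) := rfl

variable (p m k) in
/-- The standard permutation with `m` cycles of length `p` and `k` fixed points. -/
def standardCycles : Equiv.Perm ((ZMod p × Fin m) ⊕ Fin k) :=
  cycleTranslate (Multiplicative.ofAdd fun _ => 1)

@[simp]
theorem standardCycles_inl (a : ZMod p) (r : Fin m) :
    standardCycles p m k (Sum.inl (a, r)) = Sum.inl (a + 1, r) := rfl

@[simp]
theorem standardCycles_inr (r : Fin k) :
    standardCycles p m k (Sum.inr r) = Sum.inr r := rfl

/-- The wreath product relation; coordinatewise it identifies conjugation with the module action of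
`T₁`. -/
theorem cyclePermute_mul_cycleTranslate (σ : Equiv.Perm (Fin m)) (f : Fin m → ZMod p) :
    cyclePermute (k := k) σ * cycleTranslate (Multiplicative.ofAdd f) =
      cycleTranslate (Multiplicative.ofAdd fun r => f (σ.symm r)) * cyclePermute σ := by
  refine Equiv.ext ?_
  rintro (⟨a, r⟩ | r) <;> simp

theorem commute_standardCycles (f : Multiplicative (Fin m → ZMod p)) (σ : Equiv.Perm (Fin m))
    (τ : Equiv.Perm (Fin k)) :
    Commute (cycleTranslate f * cyclePermute σ * fixedPermute τ) (standardCycles p m k) := by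
  refine Equiv.ext ?_
  rintro (⟨a, r⟩ | r) <;> simp [add_right_comm]

theorem commute_fixedPermute (f : Multiplicative (Fin m → ZMod p)) (σ : Equiv.Perm (Fin m))
    (τ : Equiv.Perm (Fin k)) :
    Commute (cycleTranslate f * cyclePermute σ) (fixedPermute τ) := by
  refine Equiv.ext ?_
  rintro (⟨a, r⟩ | r) <;> simp

variable [NeZero p]

theorem card_support_cycleTranslate_le (f : Multiplicative (Fin m → ZMod p)) :
    (cycleTranslate (k := k) f).support.card ≤
      p * (Finset.univ.filter fun r => f.toAdd r ≠ 0).card := by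
  have h := Finset.card_product (Finset.univ : Finset (ZMod p))
    (Finset.univ.filter fun r => f.toAdd r ≠ 0)
  rw [Finset.card_univ, ZMod.card] at h
  rw [← h]
  refine le_trans (Finset.card_le_card ?_) (Finset.card_map Function.Embedding.inl).le
  rintro (⟨a, r⟩ | r) hr
  · simpa using hr
  · simp at hr

theorem card_support_cyclePermute_le (σ : Equiv.Perm (Fin m)) :
    (cyclePermute (p := p) (k := k) σ).support.card ≤ p * σ.support.card := by
  have h := Finset.card_product (Finset.univ : Finset (ZMod p)) σ.support
  rw [Finset.card_univ, ZMod.card] at h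
  rw [← h]
  refine le_trans (Finset.card_le_card ?_) (Finset.card_map Function.Embedding.inl).le
  rintro (⟨a, r⟩ | r) hr
  · simpa using hr
  · simp at hr

theorem card_support_fixedPermute_le (τ : Equiv.Perm (Fin k)) :
    (fixedPermute (p := p) (m := m) τ).support.card ≤ τ.support.card := by
  refine le_trans (Finset.card_le_card ?_) (Finset.card_map Function.Embedding.inr).le
  rintro (⟨a, r⟩ | r) hr
  · simp at hr
  · simpa using hr

section Lower

variable (f : Multiplicative (Fin m → ZMod p)) (σ : Equiv.Perm (Fin m)) (τ : Equiv.Perm (Fin k))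

theorem card_support_le_of_cycles :
    σ.support.card ≤ (cycleTranslate f * cyclePermute σ * fixedPermute τ).support.card := by
  refine Finset.card_le_card_of_injOn (fun r => Sum.inl (0, r)) (fun r hr => ?_)
    fun r _ r' _ h => by simpa using h
  simp only [Finset.mem_coe, Equiv.Perm.mem_support] at hr ⊢
  simp [hr]

theorem card_support_le_of_fixed :
    τ.support.card ≤ (cycleTranslate f * cyclePermute σ * fixedPermute τ).support.card := by
  refine Finset.card_le_card_of_injOn Sum.inr (fun r hr => ?_)
    fun r _ r' _ h => by simpa using h
  simp only [Finset.mem_coe, Equiv.Perm.mem_support] at hr ⊢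
  simpa using hr

/-- The test point `(0, σ.symm r)` is first carried into cycle `r`, where the translation changes
its first coordinate to `f r`. -/
theorem card_support_le_of_translate :
    (Finset.univ.filter fun r => f.toAdd r ≠ 0).card ≤
      (cycleTranslate f * cyclePermute σ * fixedPermute τ).support.card := by
  refine Finset.card_le_card_of_injOn (fun r => Sum.inl (0, σ.symm r)) (fun r hr => ?_)
    fun r _ r' _ h => by simpa using h
  simp only [Finset.mem_coe, Equiv.Perm.mem_support, Finset.mem_filter] at hr ⊢
  simp [hr.2]

end Lower

/-- A permutation that almost commutes with `standardCycles` is close to one that commutes. -/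
theorem exists_near_of_almost_commute (hp : 1 < p)
    (g : Equiv.Perm ((ZMod p × Fin m) ⊕ Fin k)) :
    ∃ (f : Multiplicative (Fin m → ZMod p)) (σ : Equiv.Perm (Fin m)) (τ : Equiv.Perm (Fin k)),
      (Finset.univ.filter fun j =>
        (cycleTranslate f * cyclePermute σ * fixedPermute τ : Equiv.Perm _) j ≠ g j).card ≤
      p * (Finset.univ.filter fun j =>
        (g * standardCycles p m k) j ≠ (standardCycles p m k * g) j).card := by
  classical
  set B := Finset.univ.filter fun j =>
    (g * standardCycles p m k) j ≠ (standardCycles p m k * g) j with hB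
  have hnB : ∀ j, j ∉ B → g (standardCycles p m k j) = standardCycles p m k (g j) := by
    intro j hj
    by_contra h
    exact hj (Finset.mem_filter.2 ⟨Finset.mem_univ _, h⟩)
  -- On a cycle with no bad point, `g` is determined by its value at one point and is a rotation
  -- onto another cycle. It cannot reach a fixed point, by injectivity.
  let R : Finset (Fin m) := Finset.univ.filter fun r => ∀ a, Sum.inl (a, r) ∉ B
  let Q : Finset (Fin k) := Finset.univ.filter fun r => Sum.inr r ∉ B
  have hR : ∀ r ∈ R, ∃ c : ZMod p × Fin m, ∀ a, g (Sum.inl (a, r)) = Sum.inl (c.1 + a, c.2) := by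
    intro r hr
    replace hr := (Finset.mem_filter.1 hr).2
    rcases h0 : g (Sum.inl (0, r)) with ⟨b, s⟩ | s
    · refine ⟨(b, s), fun a => ?_⟩
      obtain ⟨l, rfl⟩ := ZMod.natCast_zmod_surjective a
      induction l with
      | zero => simpa using h0
      | succ l ih =>
        have h1 := hnB _ (hr l)
        rw [ih] at h1
        simpa [add_assoc] using h1
    · have h1 := hnB _ (hr 0)
      rw [h0] at h1
      have h2 := g.injective (h1.trans (standardCycles_inr s |>.trans h0.symm))
      have h3 : Fact (1 < p) := ⟨hp⟩
      simp at h2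
  have hQ : ∀ r ∈ Q, ∃ s, g (Sum.inr r) = Sum.inr s := by
    intro r hr
    replace hr := (Finset.mem_filter.1 hr).2
    have h1 := hnB _ hr
    rw [standardCycles_inr] at h1
    rcases h0 : g (Sum.inr r) with ⟨b, s⟩ | s
    · have h3 : Fact (1 < p) := ⟨hp⟩
      rw [h0] at h1
      simp at h1
    · exact ⟨s, rfl⟩
  choose! c hc using hR
  choose! q hq using hQ
  obtain ⟨σ, hσ⟩ := exists_perm_extending R (fun r => (c r).2) (by
    intro r hr r' hr' h
    -- The point of each cycle landing at coordinate 0: two good cycles with the same target would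
    -- share this image.
    have h1 := hc r hr (-(c r).1)
    have h2 := hc r' hr' (-(c r').1)
    simp only at h
    rw [add_neg_cancel] at h1 h2
    rw [← h, ← h1] at h2
    have := g.injective h2
    simp at this
    exact this.2.symm)
  obtain ⟨τ, hτ⟩ := exists_perm_extending Q q (by
    intro r hr r' hr' h
    have h1 := hq r hr
    have h2 := hq r' hr'
    rw [← h, ← h1] at h2
    simpa using (g.injective h2).symm)
  refine ⟨Multiplicative.ofAdd fun r => (c (σ.symm r)).1, σ, τ, ?_⟩
  -- A bad point spoils at most the `p` points of its own cycle, so the errors lie in an image of `B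
  -- ×ˢ univ`.
  have hcard : (B ×ˢ (Finset.univ : Finset (ZMod p))).card = p * B.card := by
    rw [Finset.card_product, Finset.card_univ, ZMod.card, mul_comm]
  rw [← hcard]
  refine le_trans (Finset.card_le_card ?_) (Finset.card_image_le (f := fun x :
    ((ZMod p × Fin m) ⊕ Fin k) × ZMod p => Sum.map (fun y => (x.2, y.2)) id x.1))
  rintro (⟨a, r⟩ | r) hr
  · have hrR : r ∉ R := by
      intro h
      refine (Finset.mem_filter.1 hr).2 ?_
      have h1 : σ.symm (c r).2 = r := by rw [← hσ r h, Equiv.symm_apply_apply]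
      simp [hc r h, hσ r h, h1, add_comm a]
    obtain ⟨b, hb⟩ : ∃ b, Sum.inl (b, r) ∈ B := by
      by_contra! h
      exact hrR (Finset.mem_filter.2 ⟨Finset.mem_univ _, h⟩)
    exact Finset.mem_image.2 ⟨(Sum.inl (b, r), a), by simpa using hb, rfl⟩
  · have hrB : Sum.inr r ∈ B := by
      by_contra h
      have hQ : r ∈ Q := Finset.mem_filter.2 ⟨Finset.mem_univ _, h⟩
      refine (Finset.mem_filter.1 hr).2 ?_
      simp [hq r hQ, hτ r hQ]
    exact Finset.mem_image.2 ⟨(Sum.inr r, 0), by simpa using hrB, rfl⟩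

end StandardCycles

/-! ### The centralizer in the quotient -/

section CentralizerStructure

variable {ω : Ultrafilter ℕ} {m k : ℕ → ℕ} {p : ℕ} [Fact p.Prime]

/-- The point sets on which `standardCycles` acts. -/
abbrev cyclePoints (p : ℕ) (m k : ℕ → ℕ) (i : ℕ) : Type := (ZMod p × Fin (m i)) ⊕ Fin (k i)

variable (k) in
/-- Translations along cycles, up to negligible changes. -/
def asymptoticTranslate {T : Type} [Group T] (E : T →* AsymptoticPerm ω m fun i => Fin (m i)) :
    Multiplicative (AsymptoticModule p E) →* AsymptoticPerm ω m (cyclePoints p m k) :=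
  MonoidHom.mk' (fun x => Quotient.lift (s := (funNull ω m p).quotientRel)
    (fun f => ((fun i => cycleTranslate (Multiplicative.ofAdd (f i)) :
      ∀ i, Equiv.Perm (cyclePoints p m k i)) : AsymptoticPerm ω m (cyclePoints p m k)))
    (by
      intro f g hfg
      replace hfg := (Submodule.quotientRel_def _).1 hfg
      rw [eq_comm, QuotientGroup.eq, mem_permNull]
      refine (Negligible.const_mul p (mem_funNull.1 hfg)).mono' fun i => ?_
      rw [Pi.mul_apply, Pi.inv_apply, ← map_inv, ← map_mul]
      refine (card_support_cycleTranslate_le _).trans_eq ?_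
      simp [sub_eq_neg_add]) x.toAdd) (by
    intro x y
    obtain ⟨f, hf⟩ := Submodule.Quotient.mk_surjective (funNull ω m p) x.toAdd
    obtain ⟨g, hg⟩ := Submodule.Quotient.mk_surjective (funNull ω m p) y.toAdd
    rw [toAdd_mul, ← hf, ← hg]
    refine congrArg (QuotientGroup.mk (s := permNull ω m (cyclePoints p m k))) ?_
    funext i
    exact map_mul _ _ _)

/-- Permutations of cycles, up to negligible changes. -/
def asymptoticCyclePermute : AsymptoticPerm ω m (fun i => Fin (m i)) →*
    AsymptoticPerm ω m (cyclePoints p m k) :=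
  QuotientGroup.map _ _ (MonoidHom.piMap fun _ => cyclePermute) (by
    intro σ hσ
    rw [Subgroup.mem_comap, mem_permNull]
    exact (Negligible.const_mul p hσ).mono' fun i => card_support_cyclePermute_le (σ i))

/-- Permutations of fixed points, up to negligible changes. -/
def asymptoticFixedPermute : AsymptoticPerm ω m (fun i => Fin (k i)) →*
    AsymptoticPerm ω m (cyclePoints p m k) :=
  QuotientGroup.map _ _ (MonoidHom.piMap fun _ => fixedPermute) (by
    intro τ hτ
    rw [Subgroup.mem_comap, mem_permNull]
    exact Negligible.mono' hτ fun i => card_support_fixedPermute_le (τ i))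

variable {T : Type} [Group T] (E : T ≃* AsymptoticPerm ω m fun i => Fin (m i))

theorem asymptoticTranslate_comp_moduleAut (t : T) :
    (asymptoticTranslate k E.toMonoidHom).comp
        (moduleAut (ZMod p) T (AsymptoticModule p E.toMonoidHom) t).toMonoidHom =
      (MulAut.conj ((asymptoticCyclePermute.comp E.toMonoidHom) t)).toMonoidHom.comp
        (asymptoticTranslate k E.toMonoidHom) := by
  refine MonoidHom.ext fun x => ?_
  obtain ⟨σ, hσ⟩ := QuotientGroup.mk_surjective (E t)
  obtain ⟨f, hf⟩ := Submodule.Quotient.mk_surjective (funNull ω m p) x.toAdd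
  obtain rfl : x = Multiplicative.ofAdd
      (show AsymptoticModule p E.toMonoidHom from Submodule.Quotient.mk f) := hf.symm
  change asymptoticTranslate (p := p) k E.toMonoidHom
      (moduleAut (ZMod p) T (AsymptoticModule p E.toMonoidHom) t _) =
    asymptoticCyclePermute (E t) * _ * (asymptoticCyclePermute (E t))⁻¹
  rw [moduleAut_apply, single_smul_mk E.toMonoidHom t σ hσ.symm, eq_mul_inv_iff_mul_eq, ← hσ]
  refine congrArg (QuotientGroup.mk (s := permNull ω m (cyclePoints p m k))) ?_
  funext i
  exact (cyclePermute_mul_cycleTranslate (σ i) (f i)).symm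

theorem exists_representatives (x : Multiplicative (AsymptoticModule p E.toMonoidHom))
    (t : T) (y : AsymptoticPerm ω m fun i => Fin (k i)) :
    ∃ (f : ∀ i, Fin (m i) → ZMod p) (σ : ∀ i, Equiv.Perm (Fin (m i)))
      (τ : ∀ i, Equiv.Perm (Fin (k i))),
      x.toAdd = (Submodule.Quotient.mk f : AsymptoticFun ω m p) ∧ E t = σ ∧ y = τ := by
  obtain ⟨σ, hσ⟩ := QuotientGroup.mk_surjective (E t)
  obtain ⟨τ, hτ⟩ := QuotientGroup.mk_surjective y
  obtain ⟨f, hf⟩ := Submodule.Quotient.mk_surjective (funNull ω m p) x.toAdd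
  exact ⟨f, σ, τ, hf.symm, hσ.symm, hτ.symm⟩

variable (k p) in
/-- The homomorphism parametrizing the centralizer of `standardCycles`. -/
noncomputable def centralizerHom :
    (Multiplicative (AsymptoticModule p E.toMonoidHom)
      ⋊[moduleAut (ZMod p) T (AsymptoticModule p E.toMonoidHom)] T) ×
        AsymptoticPerm ω m (fun i => Fin (k i)) →* AsymptoticPerm ω m (cyclePoints p m k) :=
  MonoidHom.noncommCoprod
    (SemidirectProduct.lift (asymptoticTranslate k E.toMonoidHom)
      (asymptoticCyclePermute.comp E.toMonoidHom) (asymptoticTranslate_comp_moduleAut E))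
    asymptoticFixedPermute (by
      rintro ⟨x, t⟩ y
      obtain ⟨f, σ, τ, hf, hσ, rfl⟩ := exists_representatives E x t y
      obtain rfl : x = Multiplicative.ofAdd
        (show AsymptoticModule p E.toMonoidHom from Submodule.Quotient.mk f) := hf
      change asymptoticTranslate k E.toMonoidHom _ * asymptoticCyclePermute (E t) * _ =
        _ * (asymptoticTranslate k E.toMonoidHom _ * asymptoticCyclePermute (E t))
      rw [hσ]
      refine congrArg (QuotientGroup.mk (s := permNull ω m (cyclePoints p m k))) ?_
      funext i
      exact commute_fixedPermute (Multiplicative.ofAdd (f i)) (σ i) (τ i))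

theorem centralizerHom_mk {f : ∀ i, Fin (m i) → ZMod p} {t : T}
    {σ : ∀ i, Equiv.Perm (Fin (m i))} (hσ : E t = σ) (τ : ∀ i, Equiv.Perm (Fin (k i))) :
    centralizerHom k p E (⟨Multiplicative.ofAdd
        (show AsymptoticModule p E.toMonoidHom from Submodule.Quotient.mk f), t⟩, τ) =
      ((fun i => cycleTranslate (Multiplicative.ofAdd (f i)) * cyclePermute (σ i) *
        fixedPermute (τ i) : ∀ i, Equiv.Perm (cyclePoints p m k i)) :
        AsymptoticPerm ω m (cyclePoints p m k)) := by
  change asymptoticTranslate k E.toMonoidHom _ * asymptoticCyclePermute (E t) * _ = _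
  rw [hσ]
  rfl

/-- The support of a product bounds the contribution of each of its three factors, so if the product
is null then so is every factor. -/
theorem centralizerHom_injective : Function.Injective (centralizerHom k p E) := by
  rw [injective_iff_map_eq_one]
  rintro ⟨⟨x, t⟩, y⟩ h
  obtain ⟨f, σ, τ, hf, hσ, rfl⟩ := exists_representatives E x t y
  obtain rfl : x = Multiplicative.ofAdd
    (show AsymptoticModule p E.toMonoidHom from Submodule.Quotient.mk f) := hf
  rw [centralizerHom_mk E hσ, QuotientGroup.eq_one_iff, mem_permNull] at h
  have h1 : (Submodule.Quotient.mk f : AsymptoticFun ω m p) = 0 :=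
    (Submodule.Quotient.mk_eq_zero _).2
      (h.mono' fun i => card_support_le_of_translate (Multiplicative.ofAdd (f i)) (σ i) (τ i))
  have h2 : t = 1 := by
    rw [← map_eq_one_iff E E.injective, hσ, QuotientGroup.eq_one_iff]
    exact h.mono' fun i => card_support_le_of_cycles _ (σ i) _
  have h3 : (τ : AsymptoticPerm ω m fun i => Fin (k i)) = 1 :=
    (QuotientGroup.eq_one_iff _).2 (h.mono' fun i => card_support_le_of_fixed _ _ (τ i))
  rw [h3, h2, h1]
  rfl

/-- Commuting in the quotient means commuting off a negligible set; `exists_near_of_almost_commute`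
corrects this to exact commutation, losing only the constant factor `p`. -/
theorem range_centralizerHom :
    (centralizerHom k p E).range = Subgroup.centralizer
      {((fun i => standardCycles p (m i) (k i) : ∀ i, Equiv.Perm (cyclePoints p m k i)) :
        AsymptoticPerm ω m (cyclePoints p m k))} := by
  ext z
  rw [Subgroup.mem_centralizer_singleton_iff]
  constructor
  · rintro ⟨⟨⟨x, t⟩, y⟩, rfl⟩
    obtain ⟨f, σ, τ, hf, hσ, rfl⟩ := exists_representatives E x t y
    obtain rfl : x = Multiplicative.ofAdd
      (show AsymptoticModule p E.toMonoidHom from Submodule.Quotient.mk f) := hf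
    rw [centralizerHom_mk E hσ]
    refine congrArg (QuotientGroup.mk (s := permNull ω m (cyclePoints p m k))) ?_
    funext i
    exact commute_standardCycles (Multiplicative.ofAdd (f i)) (σ i) (τ i)
  · intro h
    obtain ⟨g, rfl⟩ := QuotientGroup.mk_surjective z
    rw [← QuotientGroup.mk_mul, ← QuotientGroup.mk_mul, AsymptoticPerm.mk_eq_iff] at h
    choose f σ τ hfστ using fun i =>
      exists_near_of_almost_commute (Fact.out : p.Prime).one_lt (g i)
    refine ⟨(⟨Multiplicative.ofAdd (show AsymptoticModule p E.toMonoidHom from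
      Submodule.Quotient.mk fun i => (f i).toAdd), E.symm σ⟩, τ), ?_⟩
    rw [centralizerHom_mk E (E.apply_symm_apply _), AsymptoticPerm.mk_eq_iff]
    exact (h.const_mul p).mono' hfστ

end CentralizerStructure

/-! ### Approximating by exact `p`-torsion and normalizing it -/

section PrimeOrder

variable {p : ℕ} [Fact p.Prime]

theorem card_support_le_add {α : Type*} [Fintype α] [DecidableEq α] (a b : Equiv.Perm α) :
    a.support.card ≤ b.support.card + (Finset.univ.filter fun j => a j ≠ b j).card := by
  refine le_trans (Finset.card_le_card fun j hj => ?_) (Finset.card_union_le _ _)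
  rw [Finset.mem_union, Equiv.Perm.mem_support, Finset.mem_filter]
  rw [Equiv.Perm.mem_support] at hj
  by_cases h : b j = j
  · exact Or.inr ⟨Finset.mem_univ _, by rwa [h]⟩
  · exact Or.inl h

/-- The fixed set of `σ ^ p` is preserved by `σ`; keep `σ` there and take the identity elsewhere. -/
theorem exists_pow_eq_one_near {α : Type*} [Fintype α] [DecidableEq α] (σ : Equiv.Perm α) (p : ℕ) :
    ∃ y : Equiv.Perm α, y ^ p = 1 ∧
      (Finset.univ.filter fun j => σ j ≠ y j).card ≤ (σ ^ p).support.card := by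
  have h : ∀ j, (σ ^ p) (σ j) = σ j ↔ (σ ^ p) j = j := fun j => by
    rw [← Equiv.Perm.mul_apply, (Commute.pow_self σ p).eq, Equiv.Perm.mul_apply, σ.injective.eq_iff]
  refine ⟨Equiv.Perm.ofSubtype (σ.subtypePerm (p := fun j => (σ ^ p) j = j) h), ?_,
    Finset.card_le_card fun j hj => ?_⟩
  · rw [← map_pow, Equiv.Perm.subtypePerm_pow, map_eq_one_iff _ Equiv.Perm.ofSubtype_injective]
    ext ⟨j, hj⟩
    simpa using hj
  · rw [Equiv.Perm.mem_support]
    intro hj'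
    refine (Finset.mem_filter.1 hj).2 ?_
    exact (Equiv.Perm.ofSubtype_apply_of_mem
      (σ.subtypePerm (p := fun j => (σ ^ p) j = j) h) hj').symm

/-- Every nontrivial cycle has length `p`, so the support size fixes the cycle type. -/
theorem isConj_of_pow_prime_eq_one {α : Type*} [Fintype α] [DecidableEq α] {a b : Equiv.Perm α}
    (ha : a ^ p = 1) (hb : b ^ p = 1) (h : a.support.card = b.support.card) : IsConj a b := by
  have key : ∀ c : Equiv.Perm α, c ^ p = 1 →
      c.cycleType = Multiset.replicate (c.support.card / p) p := by
    intro c hc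
    have h1 := Multiset.eq_replicate_card.2 (Equiv.Perm.pow_prime_eq_one_iff.1 hc)
    have h2 := c.sum_cycleType
    rw [h1, Multiset.sum_replicate, smul_eq_mul] at h2
    rw [← h2, Nat.mul_div_cancel _ (Fact.out : p.Prime).pos]
    exact h1
  rw [Equiv.Perm.isConj_iff_cycleType_eq, key a ha, key b hb, h]

theorem standardCycles_pow (m k : ℕ) : standardCycles p m k ^ p = 1 := by
  rw [standardCycles, ← map_pow, ← ofAdd_nsmul]
  have : (p • fun _ : Fin m => (1 : ZMod p)) = 0 := by
    ext
    simp
  rw [this, ofAdd_zero, map_one]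

theorem card_support_standardCycles (m k : ℕ) : (standardCycles p m k).support.card = p * m := by
  have : (standardCycles p m k).support =
      (Finset.univ : Finset (ZMod p × Fin m)).map Function.Embedding.inl := by
    ext (⟨a, r⟩ | r) <;> simp
  rw [this, Finset.card_map, Finset.card_univ, Fintype.card_prod, ZMod.card, Fintype.card_fin]

theorem exists_equiv_standardCycles {n : ℕ} {y : Equiv.Perm (Fin n)} (hy : y ^ p = 1) :
    ∃ (m k : ℕ) (e : Fin n ≃ (ZMod p × Fin m) ⊕ Fin k), n = p * m + k ∧
      y.support.card = p * m ∧ e.permCongr y = standardCycles p m k := by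
  obtain ⟨m, hm⟩ : p ∣ y.support.card := by
    rw [← Equiv.Perm.sum_cycleType]
    exact Multiset.dvd_sum fun c hc => (Equiv.Perm.pow_prime_eq_one_iff.1 hy c hc).symm.dvd
  have hle : p * m ≤ n := by
    rw [← hm]
    simpa using Finset.card_le_univ y.support
  obtain ⟨k, rfl⟩ := Nat.exists_eq_add_of_le hle
  have e₀ : Fin (p * m + k) ≃ (ZMod p × Fin m) ⊕ Fin k := Fintype.equivOfCardEq (by simp [ZMod.card])
  have hconj : IsConj (e₀.permCongr y) (standardCycles p m k) := by
    refine isConj_of_pow_prime_eq_one (p := p) ?_ (standardCycles_pow m k) ?_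
    · change (e₀.permCongrHom y) ^ p = 1
      rw [← map_pow, hy, map_one]
    · rw [card_support_permCongr, hm, card_support_standardCycles]
  obtain ⟨c, hc⟩ := isConj_iff.1 hconj
  refine ⟨m, k, e₀.trans c, rfl, hm, ?_⟩
  rw [← hc]
  ext j
  rfl

end PrimeOrder

/-! ### Comparison of scales and assembly of the theorem -/

section Main

variable {ω : Ultrafilter ℕ} {n : ℕ → ℕ}

theorem hammingLength_eq_one_iff (hn : Tendsto n (ω : Filter ℕ) atTop)
    (g : ∀ i, alternatingGroup (Fin (n i))) :
    hammingLength ω n (g : AltUltraproduct ω n) = 1 ↔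
      Negligible ω n fun i => n i - (g i : Equiv.Perm (Fin (n i))).support.card := by
  rw [← Negligible.tendsto_iff fun i => Nat.sub_le _ _]
  have h1 : Tendsto (fun i => 1 - (1 / (n i : ℝ)) *
      ((g i : Equiv.Perm (Fin (n i))).support.card : ℝ)) (ω : Filter ℕ)
      (𝓝 (1 - hammingLength ω n (g : AltUltraproduct ω n))) :=
    (tendsto_ultraDist ω (fun i => altMetric (n i)) g 1).const_sub 1
  have h2 : (fun i => 1 - (1 / (n i : ℝ)) * ((g i : Equiv.Perm (Fin (n i))).support.card : ℝ))
      =ᶠ[(ω : Filter ℕ)] fun i => (1 / (n i : ℝ)) *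
        ((n i - (g i : Equiv.Perm (Fin (n i))).support.card : ℕ) : ℝ) := by
    filter_upwards [hn.eventually_ge_atTop 1] with i hi
    have h3 : (g i : Equiv.Perm (Fin (n i))).support.card ≤ n i := by
      simpa using Finset.card_le_univ (g i : Equiv.Perm (Fin (n i))).support
    have h4 : (n i : ℝ) ≠ 0 := by positivity
    rw [Nat.cast_sub h3]
    field_simp
  rw [tendsto_congr' h2] at h1
  constructor
  · intro h
    rwa [h, sub_self] at h1
  · intro h
    linarith [tendsto_nhds_unique h1 h]

theorem tendsto_of_lt_mul {s : ℕ → ℕ} (hn : Tendsto n (ω : Filter ℕ) atTop) {K : ℕ}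
    (hK : ∀ᶠ i in (ω : Filter ℕ), n i < K * s i) : Tendsto s (ω : Filter ℕ) atTop := by
  rw [tendsto_atTop]
  intro b
  filter_upwards [hK, hn.eventually_ge_atTop (K * b)] with i h1 h2
  exact (lt_of_mul_lt_mul_left (h2.trans_lt h1) (Nat.zero_le K)).le

theorem negligible_iff_of_lt_mul {s : ℕ → ℕ} (hs : ∀ i, s i ≤ n i) {K : ℕ}
    (hK : ∀ᶠ i in (ω : Filter ℕ), n i < K * s i) (c : ℕ → ℕ) :
    Negligible ω s c ↔ Negligible ω n c :=
  ⟨fun h => h.of_scale_le 1 (Eventually.of_forall fun i => by simpa using hs i),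
    fun h => h.of_scale_le K (hK.mono fun _ h => h.le)⟩

/-- An isomorphism maps centralizers to centralizers. -/
def centralizerCongr {G H : Type*} [Group G] [Group H] (e : G ≃* H) (x : G) :
    Subgroup.centralizer {x} ≃* Subgroup.centralizer {e x} :=
  (e.subgroupMap _).trans (MulEquiv.subgroupCongr (by
    ext z
    change z ∈ Subgroup.map (MulEquiv.toMonoidHom e) _ ↔ _
    rw [Subgroup.mem_map_equiv, Subgroup.mem_centralizer_singleton_iff,
      Subgroup.mem_centralizer_singleton_iff, ← e.injective.eq_iff]
    simp))

theorem mainTheorem4 (ω : Ultrafilter ℕ) (hω : ∀ a : ℕ, ω ≠ pure a)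
    (n : ℕ → ℕ) (hn : Tendsto n (ω : Filter ℕ) atTop)
    (p : ℕ) (hp : p.Prime) (x : AltUltraproduct ω n) (hx : orderOf x = p) :
    ∃ m : ℕ → ℕ, Tendsto m (ω : Filter ℕ) atTop ∧
    ∃ (M : Type) (_ : AddCommGroup M)
      (_ : Module (MonoidAlgebra (ZMod p) (AltUltraproduct ω m)) M)
      (T₂ : Type) (_ : Group T₂),
      Infinite M ∧
      (∃ N : Submodule (MonoidAlgebra (ZMod p) (AltUltraproduct ω m)) M,
        Nat.card N = p ∧
        IsSimpleModule (MonoidAlgebra (ZMod p) (AltUltraproduct ω m)) (M ⧸ N)) ∧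
      (hammingLength ω n x < 1 →
        ∃ k : ℕ → ℕ, Tendsto k (ω : Filter ℕ) atTop ∧
          Nonempty (T₂ ≃* AltUltraproduct ω k)) ∧
      (hammingLength ω n x = 1 → Finite T₂) ∧
      Nonempty (Subgroup.centralizer {x} ≃*
        (Multiplicative M ⋊[moduleAut (ZMod p) (AltUltraproduct ω m) M] AltUltraproduct ω m)
          × T₂) := by
  have : Fact p.Prime := ⟨hp⟩
  obtain ⟨g, rfl⟩ := QuotientGroup.mk_surjective x
  let σ : ∀ i, Equiv.Perm (Fin (n i)) := fun i => g i
  have hσ : ¬ Negligible ω n fun i => (σ i).support.card := by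
    intro h
    have h1 : (g : AltUltraproduct ω n) = 1 := (QuotientGroup.eq_one_iff _).2 (mem_altNull.2 h)
    rw [h1, orderOf_one] at hx
    exact hp.one_lt.ne hx
  have hσp : Negligible ω n fun i => (σ i ^ p).support.card := by
    have h1 := pow_orderOf_eq_one (g : AltUltraproduct ω n)
    rw [hx, ← QuotientGroup.mk_pow, QuotientGroup.eq_one_iff, mem_altNull] at h1
    exact h1
  choose y hyp hyσ using fun i => exists_pow_eq_one_near (σ i) p
  choose m k e hmk hym hey using fun i => exists_equiv_standardCycles (hyp i)
  have hnear : Negligible ω n fun i => (Finset.univ.filter fun j => σ i j ≠ y i j).card :=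
    hσp.mono' hyσ
  -- Otherwise `y`, and with it the nearby `σ`, would be null, contradicting `x ≠ 1`.
  have hpm : ¬ Negligible ω n fun i => p * m i := by
    intro h
    refine hσ ((h.add hnear).mono' fun i => ?_)
    rw [← hym]
    exact card_support_le_add _ _
  obtain ⟨K, hK⟩ := Negligible.exists_of_not hpm
  simp only [← mul_assoc] at hK
  have hmn : ∀ i, m i ≤ n i := fun i => by
    have := Nat.le_mul_of_pos_left (m i) hp.pos
    have := hmk i
    omega
  have hm := tendsto_of_lt_mul hn hK
  have hnm := negligible_iff_of_lt_mul hmn hK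
  -- `k i` counts the fixed points of `y i`, which differ in number from those of `σ i` by a
  -- negligible amount.
  have hk : hammingLength ω n (g : AltUltraproduct ω n) = 1 ↔ Negligible ω n k := by
    rw [hammingLength_eq_one_iff hn]
    constructor <;> intro h <;> refine (h.add hnear).mono' fun i => ?_
    · have h1 := card_support_le_add (σ i) (y i)
      have h2 := hmk i
      have h3 := hym i
      change k i ≤ n i - (σ i).support.card + _
      omega
    · have h1 := card_support_le_add (y i) (σ i)
      have h2 := hmk i
      have h3 := hym i
      simp only [ne_comm (a := y i _)] at h1
      change n i - (σ i).support.card ≤ _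
      omega
  let E : AltUltraproduct ω m ≃* AsymptoticPerm ω m fun i => Fin (m i) :=
    altEquivAsymptoticPerm hm fun _ _ => Iff.rfl
  let Φ : AltUltraproduct ω n ≃* AsymptoticPerm ω m (cyclePoints p m k) :=
    (altEquivAsymptoticPerm hm fun c _ => (hnm c).symm).trans (AsymptoticPerm.congr e)
  have hΦ : Φ g = ((fun i => standardCycles p (m i) (k i) :
      ∀ i, Equiv.Perm (cyclePoints p m k i)) : AsymptoticPerm ω m (cyclePoints p m k)) := by
    have h1 : (σ : AsymptoticPerm ω m fun i => Fin (n i)) = y :=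
      AsymptoticPerm.mk_eq_iff.2 ((hnm _).2 hnear)
    change AsymptoticPerm.congr e (σ : AsymptoticPerm ω m fun i => Fin (n i)) = _
    rw [h1]
    refine congrArg (QuotientGroup.mk (s := permNull ω m (cyclePoints p m k))) ?_
    funext i
    exact hey i
  refine ⟨m, hm, AsymptoticModule p E.toMonoidHom, inferInstance, inferInstance,
    AsymptoticPerm ω m fun i => Fin (k i), inferInstance, infinite_asymptoticFun hm,
    ⟨constSubmodule p E.toMonoidHom, card_constSubmodule _ hm,
      isSimpleModule_quotient_constSubmodule _ hm E.surjective⟩, fun hl => ?_, fun hl => ?_, ⟨?_⟩⟩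
  · obtain ⟨L, hL⟩ := Negligible.exists_of_not fun h => hl.ne (hk.2 h)
    have hkn : ∀ i, k i ≤ n i := fun i => by
      have := hmk i
      omega
    exact ⟨k, tendsto_of_lt_mul hn hL, ⟨(altEquivAsymptoticPerm hm fun c _ =>
      (negligible_iff_of_lt_mul hkn hL c).trans (hnm c).symm).symm⟩⟩
  -- With `k` negligible every permutation of the fixed points is null, so `T₂` is trivial.
  · have h1 : ∀ z : AsymptoticPerm ω m fun i => Fin (k i), z = 1 := by
      intro z
      obtain ⟨τ, rfl⟩ := QuotientGroup.mk_surjective z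
      refine (QuotientGroup.eq_one_iff _).2 (((hnm _).2 (hk.1 hl)).mono' fun i => ?_)
      simpa using Finset.card_le_univ (τ i).support
    have : Subsingleton (AsymptoticPerm ω m fun i => Fin (k i)) :=
      ⟨fun a b => (h1 a).trans (h1 b).symm⟩
    infer_instance
  · refine (centralizerCongr Φ _).trans (MulEquiv.trans (MulEquiv.subgroupCongr ?_)
      (MonoidHom.ofInjective (centralizerHom_injective (p := p) (k := k) E)).symm)
    rw [hΦ, range_centralizerHom]

end Main
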